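/- Let $n\ge 3$, let $C_n$ be the cycle with vertex set $\mathbb{Z}_n$, in which $i$ and $j$ are adjacent if and only if $i-j\equiv\pm1\pmod n$ (all edges of weight $1$), let $b\in\mathbb{Z}_n\setminus\{0\}$ and let $\rho$ be a positive integer. Let $C_n+\rho\{0,b\}$ be the weighted graph obtained from $C_n$ by adding an edge of weight $\rho$ between $0$ and $b$ (if $0$ and $b$ are already adjacent, the weight of that edge becomes $1+\rho$). Let $Q=\Delta+A$ be its signless Laplacian matrix, where $A$ is the weighted adjacency matrix and $\Delta$ is the diagonal matrix of the row sums of $A$, and let $U(t)=\exp(itQ)$ for $t\in\mathbb{R}$. A pair state is a vector $\mathbf{x}=\frac{1}{\sqrt2}(\mathbf{e}_k-\mathbf{e}_l)$ with $k\ne l$, and $D_{\mathbf x}=\mathbf{x}\mathbf{x}^T$ is its density matrix. The graph exhibits perfect pair state transfer with respect to the signless Laplacian matrix if there are pair states $\mathbf{x},\mathbf{y}$ with $D_{\mathbf x}\neq D_{\mathbf y}$ and a time $\tau>0$ such that $D_{\mathbf y}=U(\tau)D_{\mathbf x}U(-\tau)$ (equivalently, $U(\tau)\mathbf{x}=\gamma\mathbf{y}$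 for some $\gamma\in\mathbb{C}$). Theorem. If $b=\frac n2$ (so $n$ is even) and $n\ge16$, then $C_n+\rho\{0,b\}$ does not exhibit perfect pair state transfer with respect to the signless Laplacian matrix. If $b\ne\frac n2$ and $n\ge22$, then $C_n+\rho\{0,b\}$ does not exhibit perfect pair state transfer with respect to the signless Laplacian matrix. -/

import Mathlib

open scoped NNReal Matrix

noncomputable section

/-- A finite undirected weighted graph without loops on the vertex set `V`: `weight u v` is the
positive weight of the edge `{u, v}`, and it is `0` when there is no such edge. -/
@[ext] structure WeightedGraph (V : Type*) where
  weight : V → V → ℝ≥0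
  symm : ∀ u v, weight u v = weight v u
  loopless : ∀ v, weight v v = 0

namespace WeightedGraph

variable {V : Type*}

open Classical in
/-- A simple graph as a weighted graph all of whose edges have weight one. -/
def ofSimpleGraph (G : SimpleGraph V) : WeightedGraph V where
  weight u v := if G.Adj u v then 1 else 0
  symm u v := by simp [G.adj_comm]
  loopless v := by simp

open Classical in
/-- The graph `G + ρ {u, v}`: an edge of weight `ρ` is added between `u` and `v`. If `u` and `v`
are already joined by an edge, then its weight is increased by `ρ`. -/
def addEdge (G : WeightedGraph V) (u v : V) (huv : u ≠ v) (ρ : ℝ≥0) : WeightedGraph V where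
  weight i j := G.weight i j + if s(i, j) = s(u, v) then ρ else 0
  symm i j := by rw [G.symm i j, Sym2.eq_swap]
  loopless i := by
    have h : s(i, i) ≠ s(u, v) := fun h => huv <| by
      simp only [Sym2.eq_iff] at h
      rcases h with ⟨h1, h2⟩ | ⟨h1, h2⟩
      · exact h1.symm.trans h2
      · exact h2.symm.trans h1
    simp [G.loopless i, h]

/-- The adjacency matrix. -/
def adjMatrix (G : WeightedGraph V) : Matrix V V ℝ :=
  Matrix.of fun i j => (G.weight i j : ℝ)

/-- The degree matrix: diagonal, with the row sums of the adjacency matrix on the diagonal. -/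
def degMatrix [Fintype V] [DecidableEq V] (G : WeightedGraph V) : Matrix V V ℝ :=
  Matrix.diagonal fun i => ∑ j, G.adjMatrix i j

/-- The signless Laplacian matrix `Q = Δ + A`. -/
def signlessLaplacian [Fintype V] [DecidableEq V] (G : WeightedGraph V) : Matrix V V ℝ :=
  G.degMatrix + G.adjMatrix

/-- The cycle `C_n` on the vertex set `ZMod n`: `i` and `j` are adjacent iff `i - j = ±1`. -/
def cycle (n : ℕ) : WeightedGraph (ZMod n) :=
  ofSimpleGraph (SimpleGraph.circulantGraph {(1 : ZMod n)})

end WeightedGraph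

namespace QuantumWalk

variable {V : Type*} [Fintype V] [DecidableEq V]

/-- The transition matrix `U_M(t) = exp (i t M)` of the continuous-time quantum walk. -/
def transition (M : Matrix V V ℝ) (t : ℝ) : Matrix V V ℂ :=
  NormedSpace.exp ((Complex.I * (t : ℂ)) • M.map Complex.ofReal)

/-- Perfect state transfer relative to `M` between two density matrices `D₁` and `D₂`: at some
time `τ > 0` one has `D₂ = U_M(τ) D₁ U_M(-τ)`. -/
def HasPST (M : Matrix V V ℝ) (D₁ D₂ : Matrix V V ℂ) : Prop :=
  ∃ τ : ℝ, 0 < τ ∧ D₂ = transition M τ * D₁ * transition M (-τ)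

/-- The density matrix `x xᵀ` of the real pure state given by a unit vector `x`. -/
def density (x : V → ℝ) : Matrix V V ℂ :=
  (Matrix.vecMulVec x x).map Complex.ofReal

/-- The pair state `(e_k - e_l) / √2`. -/
def pairState (k l : V) : V → ℝ :=
  (1 / √2 : ℝ) • (Pi.single k 1 - Pi.single l 1)

/-- Perfect pair state transfer relative to `M`: perfect state transfer occurs between two
distinct pair states. The states, as density matrices, have to be distinct, so periodicity of a
single pair state (which covers transfer from `(e_k - e_l) / √2` to its negative) is no transfer. -/
def HasPairPST (M : Matrix V V ℝ) : Prop :=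
  ∃ k l k' l' : V, k ≠ l ∧ k' ≠ l' ∧
    density (pairState k l) ≠ density (pairState k' l') ∧
    HasPST M (density (pairState k l)) (density (pairState k' l'))

end QuantumWalk

end

/-!
Why no pair state `e_k - e_l` of `C_n + ρ {0, b}` can be transferred.

If `U(τ)` carries one pair state to another, then the final density matrix is real, and comparing its
entries between eigenvectors gives `τ (θ - φ) ∈ π ℤ` for all eigenvalues `θ`, `φ` in the support of
the initial state (`HasPST.isCommensurable`). It is shown that no pair state has a support with this
property, whether or not the transfer ends in a different state.

*Arithmetic.* The support `Φ` of an integer vector under an integer matrix is the root set of a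
rational polynomial, and its elements are algebraic integers. If all differences in `Φ` are multiples
of one real number, the mean and the variance of `Φ` being rational makes the square of that number
rational, so `Φ` consists of integers or of quadratic irrationalities placed symmetrically about the
mean (`IsArithmetic.dichotomy`). Distinct elements have distance at least `1`, and inside `[0, 4)`
only a few sets are left: `{0, 1, 2, 3}`, `{2, 2 ± √2}`, `{2, 2 ± √3}`, `{(3 ± √5) / 2}`,
`{(5 ± √5) / 2}` and their subsets (`IsArithmetic.classification`).

*Antisymmetric part.* The reflection `i ↦ b - i` is an automorphism. On vectors that it negates, the
additional edge is invisible, `Q - 2` is `S + S⁻¹` with the cyclic shift `S`, and all eigenvalues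
are in `[0, 4)`. Chebyshev polynomials turn the list above into the statement that the antisymmetric
part of `e_k - e_l` has period `8`, `10` or `12` (`IsAntisymm.periods`). Having at most two positive
entries, it vanishes unless `n` is `16`, `20` or `24` (`periods_of_not_fixed`).

*The remaining pairs.* If `b = n / 2`, then all of them are negated by `i ↦ -i`, which preserves the
additional edge too, so `e_k - e_l` itself has a period, which is absurd. If `n = 24`, one recurrence
fails at once, and the other one determines the whole support to be in `{2, 2 ± √3}`
(`IsArithmetic.sq_sub_two_eq_three`) and then fails at a vertex far from the additional edge. If the
antisymmetric part vanishes, then `k` and `l` are the fixed points of the reflection; the graph is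
not bipartite and the edge is a perturbation of rank one, so the support has at most five elements,
while `Q ^ j (e_k - e_l)` for `j ≤ 5` are independent as long as `11 ≤ n / 2`
(`not_isCommensurable_of_fixed`).
-/

open Polynomial

namespace QuantumWalk

/-! ### Spectral support of a vector -/

section Support

variable {V : Type*} [Fintype V] [DecidableEq V]

/-- The eigenvalue support of `v` with respect to `Q`: the real numbers `θ` for which some
eigenvector of `Q` with eigenvalue `θ` is not orthogonal to `v`. For symmetric `Q` these are the
eigenvalues whose eigenprojection does not kill `v`. -/
def spectralSupport (Q : Matrix V V ℝ) (v : V → ℝ) : Set ℝ :=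
  {θ | ∃ w : V → ℝ, Q *ᵥ w = θ • w ∧ w ⬝ᵥ v ≠ 0}

theorem aeval_mulVec_of_eigenvector {Q : Matrix V V ℝ} {w : V → ℝ} {θ : ℝ}
    (hw : Q *ᵥ w = θ • w) (p : ℝ[X]) : aeval Q p *ᵥ w = p.eval θ • w := by
  induction p using Polynomial.induction_on' with
  | add p q hp hq => simp [Matrix.add_mulVec, hp, hq, add_smul]
  | monomial n a =>
    induction n generalizing a with
    | zero => simp [Algebra.algebraMap_eq_smul_one, Matrix.smul_mulVec]
    | succ n ih =>
      have h1 : (monomial (n + 1) a : ℝ[X]) = monomial n a * X := by simp [monomial_mul_X]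
      rw [h1, map_mul, aeval_X, ← Matrix.mulVec_mulVec, hw, Matrix.mulVec_smul, ih, smul_smul,
        eval_mul, eval_X, mul_comm]

theorem transpose_aeval {Q : Matrix V V ℝ} (hQ : Qᵀ = Q) (p : ℝ[X]) :
    (aeval Q p)ᵀ = aeval Q p := by
  induction p using Polynomial.induction_on' with
  | add p q hp hq => simp [hp, hq]
  | monomial n a =>
    simp [aeval_monomial, Algebra.algebraMap_eq_smul_one, Matrix.transpose_smul,
      Matrix.transpose_pow, hQ]

theorem dotProduct_aeval_mulVec {Q : Matrix V V ℝ} (hQ : Qᵀ = Q) {w : V → ℝ} {θ : ℝ}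
    (hw : Q *ᵥ w = θ • w) (p : ℝ[X]) (v : V → ℝ) :
    w ⬝ᵥ (aeval Q p *ᵥ v) = p.eval θ * (w ⬝ᵥ v) := by
  rw [Matrix.dotProduct_mulVec, ← Matrix.mulVec_transpose, transpose_aeval hQ,
    aeval_mulVec_of_eigenvector hw, smul_dotProduct, smul_eq_mul]

/-- The polynomials that annihilate `v` under a symmetric matrix are those that vanish on the
support of `v`. -/
theorem aeval_mulVec_eq_zero_iff {Q : Matrix V V ℝ} (hQ : Qᵀ = Q) (p : ℝ[X]) (v : V → ℝ) :
    aeval Q p *ᵥ v = 0 ↔ ∀ θ ∈ spectralSupport Q v, p.eval θ = 0 := by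
  constructor
  · rintro h θ ⟨w, hw, hwv⟩
    have := dotProduct_aeval_mulVec hQ hw p v
    rw [h, dotProduct_zero] at this
    exact (mul_eq_zero.mp this.symm).resolve_right hwv
  · intro h
    have hH : Q.IsHermitian := by
      rw [Matrix.IsHermitian, Matrix.conjTranspose_eq_transpose_of_trivial, hQ]
    have key : ∀ j, inner ℝ (hH.eigenvectorBasis j) (WithLp.toLp 2 (aeval Q p *ᵥ v)) = 0 := by
      intro j
      have hj := hH.mulVec_eigenvectorBasis j
      have h2 := dotProduct_aeval_mulVec hQ hj p v
      have h3 : inner ℝ (hH.eigenvectorBasis j) (WithLp.toLp 2 (aeval Q p *ᵥ v))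
          = (hH.eigenvectorBasis j : V → ℝ) ⬝ᵥ (aeval Q p *ᵥ v) := by
        simp [PiLp.inner_apply, dotProduct, mul_comm]
      rw [h3, h2]
      by_cases h0 : (hH.eigenvectorBasis j : V → ℝ) ⬝ᵥ v = 0
      · rw [h0, mul_zero]
      · rw [h _ ⟨_, hj, h0⟩, zero_mul]
    have h4 : WithLp.toLp 2 (aeval Q p *ᵥ v) = (0 : EuclideanSpace ℝ V) := by
      rw [← hH.eigenvectorBasis.sum_repr (WithLp.toLp 2 (aeval Q p *ᵥ v))]
      refine Finset.sum_eq_zero fun j _ => ?_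
      rw [OrthonormalBasis.repr_apply_apply, key j, zero_smul]
    simpa using congrArg WithLp.ofLp h4

theorem spectralSupport_finite {Q : Matrix V V ℝ} (hQ : Qᵀ = Q) (v : V → ℝ) :
    (spectralSupport Q v).Finite := by
  have h := (aeval_mulVec_eq_zero_iff hQ Q.charpoly v).mp
    (by rw [Matrix.aeval_self_charpoly, Matrix.zero_mulVec])
  refine (Q.charpoly.roots.toFinset.finite_toSet).subset fun θ hθ => ?_
  simpa [Q.charpoly_monic.ne_zero] using h θ hθ

theorem aeval_prod_mulVec_eq_zero {Q : Matrix V V ℝ} (hQ : Qᵀ = Q) {v : V → ℝ} {S : Finset ℝ}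
    (hS : spectralSupport Q v ⊆ S) : aeval Q (∏ φ ∈ S, (X - C φ)) *ᵥ v = 0 := by
  rw [aeval_mulVec_eq_zero_iff hQ]
  intro φ hφ
  rw [eval_prod]
  exact Finset.prod_eq_zero (i := φ) (hS hφ) (by simp)

theorem mem_of_aeval_prod_mulVec_eq_zero {Q : Matrix V V ℝ} (hQ : Qᵀ = Q) {v : V → ℝ}
    {S : Finset ℝ} (h : aeval Q (∏ φ ∈ S, (X - C φ)) *ᵥ v = 0) {θ : ℝ}
    (hθ : θ ∈ spectralSupport Q v) : θ ∈ S := by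
  have h3 := (aeval_mulVec_eq_zero_iff hQ _ _).mp h θ hθ
  rw [eval_prod, Finset.prod_eq_zero_iff] at h3
  obtain ⟨φ, hφ, h0⟩ := h3
  simp only [eval_sub, eval_X, eval_C, sub_eq_zero] at h0
  rwa [h0]

/-- The eigenprojection of `v` onto an eigenvalue in its support is a polynomial in the matrix
applied to `v`, so it inherits every symmetry of `v` that the matrix respects. -/
theorem exists_eigenvector_of_mem_spectralSupport {Q : Matrix V V ℝ} (hQ : Qᵀ = Q) {v : V → ℝ}
    {θ : ℝ} (hθ : θ ∈ spectralSupport Q v) :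
    ∃ p : ℝ[X], aeval Q p *ᵥ v ≠ 0 ∧ Q *ᵥ (aeval Q p *ᵥ v) = θ • (aeval Q p *ᵥ v) := by
  classical
  let S := (spectralSupport_finite hQ v).toFinset
  have hS : θ ∈ S := by simpa [S] using hθ
  refine ⟨∏ φ ∈ S.erase θ, (X - C φ), fun h => ?_, ?_⟩
  · exact Finset.notMem_erase θ S (mem_of_aeval_prod_mulVec_eq_zero hQ h hθ)
  · have h1 : aeval Q ((X - C θ) * ∏ φ ∈ S.erase θ, (X - C φ)) *ᵥ v = 0 := by
      rw [Finset.mul_prod_erase S (fun φ => X - C φ) hS]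
      exact aeval_prod_mulVec_eq_zero hQ (by simp [S])
    rw [map_mul, ← Matrix.mulVec_mulVec, map_sub, aeval_X, aeval_C, Matrix.sub_mulVec,
      sub_eq_zero, Algebra.algebraMap_eq_smul_one, Matrix.smul_mulVec, Matrix.one_mulVec] at h1
    exact h1

theorem spectralSupport_subset_of_commute {Q B : Matrix V V ℝ} (hQ : Qᵀ = Q)
    (hB : Commute Q B) (v : V → ℝ) :
    spectralSupport Q (B *ᵥ v) ⊆ spectralSupport Q v := by
  intro θ hθ
  let S := (spectralSupport_finite hQ v).toFinset
  have h1 : aeval Q (∏ φ ∈ S, (X - C φ)) *ᵥ v = 0 := aeval_prod_mulVec_eq_zero hQ (by simp [S])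
  have hc : Commute (aeval Q (∏ φ ∈ S, (X - C φ))) B := by
    rw [aeval_eq_sum_range]
    exact Commute.sum_left _ _ _ fun i _ => ((hB.pow_left i).smul_left _)
  have h2 : aeval Q (∏ φ ∈ S, (X - C φ)) *ᵥ (B *ᵥ v) = 0 := by
    rw [Matrix.mulVec_mulVec, hc.eq, ← Matrix.mulVec_mulVec, h1, Matrix.mulVec_zero]
  simpa [S] using mem_of_aeval_prod_mulVec_eq_zero hQ h2 hθ

end Support

/-! ### Perfect state transfer and the ratio condition -/

section Transfer

variable {V : Type*} [Fintype V] [DecidableEq V]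

open scoped Matrix.Norms.Operator in
theorem exp_mulVec_of_eigenvector {A : Matrix V V ℂ} {w : V → ℂ} {c : ℂ}
    (hw : A *ᵥ w = c • w) : NormedSpace.exp A *ᵥ w = Complex.exp c • w := by
  have hpow : ∀ k : ℕ, (A ^ k) *ᵥ w = c ^ k • w := by
    intro k
    induction k with
    | zero => simp
    | succ k ih =>
      rw [pow_succ, ← Matrix.mulVec_mulVec, hw, Matrix.mulVec_smul, ih, smul_smul, pow_succ,
        mul_comm]
  have h1 := NormedSpace.exp_series_hasSum_exp' (𝕂 := ℂ) A
  have h2 := NormedSpace.exp_series_hasSum_exp' (𝕂 := ℂ) c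
  rw [← Complex.exp_eq_exp_ℂ] at h2
  let L : Matrix V V ℂ →ₗ[ℂ] (V → ℂ) :=
    { toFun := fun M => M *ᵥ w
      map_add' := fun M N => Matrix.add_mulVec M N w
      map_smul' := fun a M => Matrix.smul_mulVec a M w }
  have h3 := h1.mapL (LinearMap.toContinuousLinearMap L)
  have h4 := h2.smul_const w
  refine h3.unique ?_
  have h5 : (fun k : ℕ => LinearMap.toContinuousLinearMap L ((k.factorial : ℂ)⁻¹ • A ^ k))
      = fun k : ℕ => ((k.factorial : ℂ)⁻¹ • c ^ k) • w := by
    funext k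
    change ((k.factorial : ℂ)⁻¹ • A ^ k) *ᵥ w = _
    rw [Matrix.smul_mulVec, hpow, smul_assoc]
  rw [h5]
  exact h4

theorem transition_mulVec_of_eigenvector {M : Matrix V V ℝ} {w : V → ℝ} {θ : ℝ}
    (hw : M *ᵥ w = θ • w) (t : ℝ) :
    transition M t *ᵥ (fun i => (w i : ℂ)) =
      Complex.exp (Complex.I * t * θ) • (fun i => (w i : ℂ)) := by
  apply exp_mulVec_of_eigenvector
  have key : M.map Complex.ofReal *ᵥ (fun i => (w i : ℂ)) = (θ : ℂ) • fun i => (w i : ℂ) := by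
    funext i
    have := congrFun hw i
    simp only [Matrix.mulVec, dotProduct, Pi.smul_apply, smul_eq_mul, Matrix.map_apply] at this ⊢
    exact_mod_cast this
  rw [Matrix.smul_mulVec, key, smul_smul]

theorem transpose_transition {M : Matrix V V ℝ} (hM : Mᵀ = M) (t : ℝ) :
    (transition M t)ᵀ = transition M t := by
  rw [transition, ← Matrix.exp_transpose, Matrix.transpose_smul, ← Matrix.transpose_map, hM]

/-- All differences of elements of `S` are integer multiples of one real number. -/
def IsCommensurable (S : Set ℝ) : Prop :=
  ∃ g : ℝ, ∀ θ ∈ S, ∀ φ ∈ S, ∃ m : ℤ, θ - φ = m * g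

/-- The ratio condition, from reality of the final density matrix: its entry between two
eigenvectors of `M` is the corresponding entry of the initial one times `exp (i τ (θ - φ))`. -/
theorem HasPST.isCommensurable {M : Matrix V V ℝ} (hM : Mᵀ = M) {x y : V → ℝ}
    (h : HasPST M (density x) (density y)) :
    IsCommensurable (spectralSupport M x) := by
  obtain ⟨τ, hτ, hD⟩ := h
  refine ⟨Real.pi / τ, ?_⟩
  rintro θ ⟨w, hw, hwx⟩ φ ⟨w', hw', hwx'⟩
  have h1 := transition_mulVec_of_eigenvector hw τ
  have h2 := transition_mulVec_of_eigenvector hw' (-τ)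
  have h3 := congrArg (fun D : Matrix V V ℂ =>
    (fun i => (w i : ℂ)) ⬝ᵥ (D *ᵥ (fun i => (w' i : ℂ)))) hD
  have hden : ∀ (x a c : V → ℝ), (fun i => (a i : ℂ)) ⬝ᵥ (density x *ᵥ (fun i => (c i : ℂ)))
      = (((a ⬝ᵥ x) * (c ⬝ᵥ x) : ℝ) : ℂ) := by
    intro x a c
    have : density x *ᵥ (fun i => (c i : ℂ)) = ((c ⬝ᵥ x : ℝ) : ℂ) • (fun i => (x i : ℂ)) := by
      ext i
      simp only [density, Matrix.mulVec, dotProduct, Matrix.map_apply, Matrix.vecMulVec_apply,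
        Pi.smul_apply, smul_eq_mul]
      push_cast
      rw [Finset.sum_mul]
      exact Finset.sum_congr rfl fun j _ => by ring
    rw [this, dotProduct_smul]
    simp only [dotProduct, smul_eq_mul]
    push_cast
    ring
  simp only [← Matrix.mulVec_mulVec] at h3
  rw [h2, Matrix.mulVec_smul, Matrix.mulVec_smul, dotProduct_smul,
    Matrix.dotProduct_mulVec _ (transition M τ),
    ← Matrix.mulVec_transpose (transition M τ), transpose_transition hM, h1, smul_dotProduct, hden, hden,
    smul_smul, ← Complex.exp_add, smul_eq_mul] at h3
  have harg : Complex.I * ((-τ : ℝ) : ℂ) * φ + Complex.I * τ * θ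
      = ((τ * (θ - φ) : ℝ) : ℂ) * Complex.I := by push_cast; ring
  rw [harg] at h3
  have h4 := congrArg Complex.im h3
  rw [Complex.ofReal_im, Complex.exp_mul_I, ← Complex.ofReal_cos, ← Complex.ofReal_sin,
    Complex.im_mul_ofReal] at h4
  simp only [Complex.add_im, Complex.ofReal_im, Complex.mul_im, Complex.ofReal_re, Complex.I_im,
    Complex.I_re, mul_one, mul_zero, zero_add, add_zero] at h4
  have h5 := (mul_eq_zero.mp h4.symm).resolve_right (mul_ne_zero hwx hwx')
  obtain ⟨m, hm⟩ := Real.sin_eq_zero_iff.mp h5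
  refine ⟨m, ?_⟩
  field_simp
  linarith

end Transfer

/-! ### Arithmetic of the support of an integer vector -/

/-- The properties of the support of a periodic integer vector under a symmetric integer matrix:
it is the root set of a squarefree rational polynomial, its elements are algebraic integers, and
their differences are integer multiples of one real number. -/
structure IsArithmetic (Φ : Finset ℝ) : Prop where
  rational : ∃ p : ℚ[X], p.map (algebraMap ℚ ℝ) = ∏ θ ∈ Φ, (X - C θ)
  integral : ∀ θ ∈ Φ, IsIntegral ℤ θ
  commensurable : IsCommensurable Φ

theorem exists_int_of_isIntegral {q : ℚ} (h : IsIntegral ℤ (q : ℝ)) : ∃ m : ℤ, q = m := by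
  have h1 : IsIntegral ℤ q :=
    (isIntegral_algebraMap_iff (R := ℤ) (A := ℚ) (B := ℝ) (algebraMap ℚ ℝ).injective).mp h
  obtain ⟨m, hm⟩ := IsIntegrallyClosed.isIntegral_iff.mp h1
  exact ⟨m, by simpa using hm.symm⟩

section IntegerMatrix

variable {V : Type*} [Fintype V] [DecidableEq V]

theorem isIntegral_of_mem_spectralSupport {N : Matrix V V ℤ}
    {Q : Matrix V V ℝ} (hNQ : Q = N.map (Int.castRingHom ℝ)) (hQ : Qᵀ = Q) (v : V → ℝ) {θ : ℝ}
    (hθ : θ ∈ spectralSupport Q v) : IsIntegral ℤ θ := by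
  refine ⟨N.charpoly, N.charpoly_monic, ?_⟩
  have h1 := (aeval_mulVec_eq_zero_iff hQ Q.charpoly v).mp
    (by rw [Matrix.aeval_self_charpoly, Matrix.zero_mulVec]) θ hθ
  rw [hNQ, Matrix.charpoly_map, eval_map] at h1
  exact h1

/-- A rational linear functional on `ℝ` that fixes `1`, applied to the coefficients of the
annihilating polynomial of minimal degree, gives a second monic annihilating polynomial of the same
degree, so the two agree and the coefficients are rational. -/
theorem exists_rat_map_eq_prod {N : Matrix V V ℤ}
    {Q : Matrix V V ℝ} (hNQ : Q = N.map (Int.castRingHom ℝ)) (hQ : Qᵀ = Q) {v : V → ℝ}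
    {v' : V → ℤ} (hv : v = fun i => (v' i : ℝ)) {S : Finset ℝ}
    (hS : (S : Set ℝ) = spectralSupport Q v) :
    ∃ p : ℚ[X], p.map (algebraMap ℚ ℝ) = ∏ θ ∈ S, (X - C θ) := by
  obtain ⟨f, hf⟩ := (Algebra.linearMap ℚ ℝ).exists_leftInverse_of_injective
    (LinearMap.ker_eq_bot.mpr (algebraMap ℚ ℝ).injective)
  have hf' : ∀ q : ℚ, f (q : ℝ) = q := fun q => by
    simpa using LinearMap.congr_fun hf q
  set P : ℝ[X] := ∏ θ ∈ S, (X - C θ) with hP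
  have hPm : P.Monic := monic_prod_of_monic _ _ fun θ _ => monic_X_sub_C θ
  have hPd : P.natDegree = S.card := by
    rw [hP, natDegree_prod_of_monic _ _ fun θ _ => monic_X_sub_C θ]
    simp
  let p : ℚ[X] := ∑ j ∈ Finset.range (S.card + 1), C (f (P.coeff j)) * X ^ j
  have hcoeff : ∀ j ≤ S.card, p.coeff j = f (P.coeff j) := by
    intro j hj
    simp only [p, finsetSum_coeff, coeff_C_mul, coeff_X_pow, mul_ite, mul_one, mul_zero]
    rw [Finset.sum_ite_eq, if_pos (Finset.mem_range.mpr (by omega))]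
  have hdeg : p.natDegree ≤ S.card := by
    refine natDegree_sum_le_of_forall_le _ _ fun j hj => ?_
    exact (natDegree_C_mul_X_pow_le _ _).trans (by simpa [Nat.lt_succ_iff] using hj)
  have hpow : ∀ j, ∃ u : V → ℤ, (Q ^ j) *ᵥ v = fun i => (u i : ℝ) := by
    intro j
    induction j with
    | zero => exact ⟨v', by simp [hv]⟩
    | succ j ih =>
      obtain ⟨u, hu⟩ := ih
      refine ⟨N *ᵥ u, ?_⟩
      rw [pow_succ', ← Matrix.mulVec_mulVec, hu, hNQ]
      funext i
      simp [Matrix.mulVec, dotProduct]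
  choose u hu using hpow
  have hPv := aeval_prod_mulVec_eq_zero hQ (v := v) (S := S) hS.symm.subset
  rw [← hP, aeval_eq_sum_range, hPd] at hPv
  have hpv : aeval Q (p.map (algebraMap ℚ ℝ)) *ᵥ v = 0 := by
    funext i
    have h1 := congrArg f (congrFun hPv i)
    simp only [Matrix.sum_mulVec, Matrix.smul_mulVec, hu, Finset.sum_apply, Pi.smul_apply,
      smul_eq_mul, map_sum, Pi.zero_apply, map_zero] at h1
    have h2 : ∀ j, f (P.coeff j * (u j i : ℝ)) = f (P.coeff j) * u j i := by
      intro j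
      rw [mul_comm, ← zsmul_eq_mul, map_zsmul, zsmul_eq_mul, mul_comm]
    simp only [h2] at h1
    simp only [p, Polynomial.map_sum, Polynomial.map_mul, Polynomial.map_pow, map_X, map_C,
      map_sum, map_mul, map_pow, aeval_X, aeval_C, Algebra.algebraMap_eq_smul_one (A := Matrix V V ℝ),
      smul_mul_assoc, one_mul, Matrix.sum_mulVec, Matrix.smul_mulVec, hu, Finset.sum_apply,
      Pi.smul_apply, smul_eq_mul, Pi.zero_apply]
    have h3 := congrArg (algebraMap ℚ ℝ) h1
    simpa using h3
  refine ⟨p, ?_⟩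
  have hpm : p.Monic := by
    refine monic_of_natDegree_le_of_coeff_eq_one S.card hdeg ?_
    rw [hcoeff _ le_rfl, ← hPd, hPm.coeff_natDegree]
    simpa using hf' 1
  have hpd : p.natDegree = S.card := by
    refine le_antisymm hdeg (le_natDegree_of_ne_zero ?_)
    rw [hcoeff _ le_rfl, ← hPd, hPm.coeff_natDegree]
    simpa using (hf' 1).trans_ne one_ne_zero
  have hq0 : ∀ θ ∈ S, (p.map (algebraMap ℚ ℝ)).eval θ = 0 := fun θ hθ =>
    (aeval_mulVec_eq_zero_iff hQ _ v).mp hpv θ (hS.subset hθ)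
  refine eq_of_degree_sub_lt_of_eval_finset_eq S ?_ fun θ hθ => ?_
  · have hd1 : (p.map (algebraMap ℚ ℝ)).degree = S.card := by
      rw [degree_map, degree_eq_natDegree hpm.ne_zero, hpd]
    have hd2 : P.degree = S.card := by rw [degree_eq_natDegree hPm.ne_zero, hPd]
    rw [← hd1]
    exact degree_sub_lt_left (hd1.trans hd2.symm) (hpm.map _).ne_zero
      (by rw [(hpm.map _).leadingCoeff, hPm.leadingCoeff])
  · rw [hq0 θ hθ, hP, eval_prod, Finset.prod_eq_zero hθ (by simp)]

end IntegerMatrix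

/-! ### The quadratic dichotomy -/

/-- The first two elementary symmetric functions in terms of power sums (Newton's identities). -/
theorem coeff_prod_one_sub (Φ : Finset ℝ) :
    (∏ θ ∈ Φ, (1 - C θ * X)).coeff 0 = 1 ∧
    (∏ θ ∈ Φ, (1 - C θ * X)).coeff 1 = -∑ θ ∈ Φ, θ ∧
    (∏ θ ∈ Φ, (1 - C θ * X)).coeff 2 = ((∑ θ ∈ Φ, θ) ^ 2 - ∑ θ ∈ Φ, θ ^ 2) / 2 := by
  classical
  induction Φ using Finset.induction_on with
  | empty => simp [coeff_one]
  | insert a s ha ih =>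
    obtain ⟨h0, h1, h2⟩ := ih
    rw [Finset.prod_insert ha, Finset.sum_insert ha, Finset.sum_insert ha, sub_mul, one_mul,
      mul_assoc]
    refine ⟨by simp [h0], ?_, ?_⟩
    · rw [coeff_sub, coeff_C_mul, show (1 : ℕ) = 0 + 1 from rfl, coeff_X_mul, zero_add, h1, h0]
      ring
    · rw [coeff_sub, coeff_C_mul, show (2 : ℕ) = 1 + 1 from rfl, coeff_X_mul, h1]
      norm_num [h2]
      ring

theorem reverse_prod_X_sub_C (Φ : Finset ℝ) :
    (∏ θ ∈ Φ, (X - C θ)).reverse = ∏ θ ∈ Φ, (1 - C θ * X) := by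
  classical
  induction Φ using Finset.induction_on with
  | empty => simpa using reverse_C (1 : ℝ)
  | insert a s ha ih =>
    rw [Finset.prod_insert ha, Finset.prod_insert ha, reverse_mul_of_domain, ih]
    congr 1
    rw [reverse, natDegree_X_sub_C, reflect_sub, reflect_C]
    have : reflect 1 (X : ℝ[X]) = 1 := by
      rw [← monomial_one_one_eq_X, ← C_mul_X_pow_eq_monomial, reflect_C_mul_X_pow]
      simp [revAt_le]
    rw [this, pow_one]

/-- The first two power sums of the roots are rational. -/
theorem exists_rat_power_sums {Φ : Finset ℝ} {p : ℚ[X]}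
    (hp : p.map (algebraMap ℚ ℝ) = ∏ θ ∈ Φ, (X - C θ)) :
    (∃ q : ℚ, ∑ θ ∈ Φ, θ = q) ∧ ∃ q : ℚ, ∑ θ ∈ Φ, θ ^ 2 = q := by
  have h : (p.reverse).map (algebraMap ℚ ℝ) = ∏ θ ∈ Φ, (1 - C θ * X) := by
    rw [← reverse_prod_X_sub_C, ← hp, reverse, reverse, natDegree_map, reflect_map]
  obtain ⟨-, h1, h2⟩ := coeff_prod_one_sub Φ
  rw [← h, coeff_map] at h1 h2
  have e1 : ∑ θ ∈ Φ, θ = ((-p.reverse.coeff 1 : ℚ) : ℝ) := by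
    push_cast; simp only [eq_ratCast] at h1; linarith
  refine ⟨⟨_, e1⟩, (p.reverse.coeff 1) ^ 2 - 2 * p.reverse.coeff 2, ?_⟩
  simp only [eq_ratCast] at h1 h2
  push_cast
  rw [h1, h2]
  ring

/-- Galois conjugation in a real quadratic field, for roots of a rational polynomial. -/
theorem aeval_conj_eq_zero (p : ℚ[X]) {μ r : ℚ} {d : ℝ} (hd : Irrational d) (hr : d ^ 2 = r)
    (h : aeval (μ + d : ℝ) p = 0) : aeval (μ - d : ℝ) p = 0 := by
  have hpow : ∀ n : ℕ, ∃ a b : ℚ, (μ + d : ℝ) ^ n = a + b * d ∧ (μ - d : ℝ) ^ n = a - b * d := by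
    intro n
    induction n with
    | zero => exact ⟨1, 0, by simp, by simp⟩
    | succ n ih =>
      obtain ⟨a, b, h1, h2⟩ := ih
      refine ⟨a * μ + b * r, a + b * μ, ?_, ?_⟩
      · rw [pow_succ, h1]; push_cast; rw [← hr]; ring
      · rw [pow_succ, h2]; push_cast; rw [← hr]; ring
  have key : ∃ a b : ℚ, aeval (μ + d : ℝ) p = a + b * d ∧ aeval (μ - d : ℝ) p = a - b * d := by
    clear h
    induction p using Polynomial.induction_on' with
    | add p q hp hq =>
      obtain ⟨a, b, h1, h2⟩ := hp
      obtain ⟨a', b', h1', h2'⟩ := hq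
      refine ⟨a + a', b + b', ?_, ?_⟩
      · rw [map_add, h1, h1']; push_cast; ring
      · rw [map_add, h2, h2']; push_cast; ring
    | monomial n c =>
      obtain ⟨a, b, h1, h2⟩ := hpow n
      refine ⟨c * a, c * b, ?_, ?_⟩
      · rw [aeval_monomial, h1, eq_ratCast]; push_cast; ring
      · rw [aeval_monomial, h2, eq_ratCast]; push_cast; ring
  obtain ⟨a, b, h1, h2⟩ := key
  rw [h1] at h
  have hb : b = 0 := by
    by_contra hb
    refine ((hd.ratCast_mul hb).ratCast_add a).ne_zero ?_
    exact_mod_cast h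
  subst hb
  have ha : (a : ℝ) = 0 := by simpa using h
  rw [h2, ha]
  simp

/-- Either the support consists of integers, or it lies in a coset of a line `ℚ d` with `d` a
quadratic irrationality, and it is symmetric about the rational point of that coset. That point is
the mean `μ` of the support: all `θ - μ` are rational multiples of the common unit `g`, so
rationality of `∑ (θ - μ) ^ 2` makes `g ^ 2` rational. -/
theorem IsArithmetic.dichotomy {Φ : Finset ℝ} (h : IsArithmetic Φ) :
    (∀ θ ∈ Φ, ∃ m : ℤ, θ = m) ∨
    ∃ (c : ℤ) (d : ℝ), Irrational d ∧ (∃ r : ℚ, d ^ 2 = r) ∧ (c / 2 + d : ℝ) ∈ Φ ∧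
      ∀ θ ∈ Φ, (c - θ : ℝ) ∈ Φ ∧ ∃ r : ℚ, θ = c / 2 + r * d := by
  obtain ⟨⟨p, hp⟩, hint, g, hg⟩ := h
  by_cases hall : ∀ θ ∈ Φ, ∃ q : ℚ, θ = q
  · refine Or.inl fun θ hθ => ?_
    obtain ⟨q, rfl⟩ := hall θ hθ
    obtain ⟨m, rfl⟩ := exists_int_of_isIntegral (hint _ hθ)
    exact ⟨m, by simp⟩
  right
  push Not at hall
  obtain ⟨θ₀, hθ₀, hirr⟩ := hall
  obtain ⟨⟨s1, hs1⟩, s2, hs2⟩ := exists_rat_power_sums hp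
  have hcard : (0 : ℝ) < Φ.card := by exact_mod_cast Finset.card_pos.mpr ⟨θ₀, hθ₀⟩
  obtain ⟨μ, hμ⟩ : ∃ μ : ℚ, μ = s1 / Φ.card := ⟨_, rfl⟩
  have hsum : ∑ θ ∈ Φ, θ = Φ.card * (μ : ℝ) := by
    rw [hs1, hμ]; push_cast; field_simp
  have hmult : ∀ θ ∈ Φ, ∃ t : ℚ, θ - μ = t * g := by
    intro θ hθ
    choose! m hm using hg θ hθ
    refine ⟨(∑ φ ∈ Φ, (m φ : ℚ)) / Φ.card, ?_⟩
    have h1 : ∑ φ ∈ Φ, (θ - φ) = ∑ φ ∈ Φ, (m φ : ℝ) * g := Finset.sum_congr rfl hm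
    rw [Finset.sum_sub_distrib, hsum, Finset.sum_const, nsmul_eq_mul, ← Finset.sum_mul] at h1
    push_cast
    field_simp
    linarith
  obtain ⟨t₀, ht₀⟩ := hmult θ₀ hθ₀
  have hd : Irrational (θ₀ - μ) := by
    rintro ⟨q, hq⟩
    exact hirr (μ + q) (by push_cast; linarith)
  have ht₀' : (t₀ : ℝ) ≠ 0 := by
    intro h0
    rw [h0, zero_mul] at ht₀
    exact hd.ne_zero ht₀
  have hmult' : ∀ θ ∈ Φ, ∃ r : ℚ, θ = μ + r * (θ₀ - μ) := by
    intro θ hθ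
    obtain ⟨t, ht⟩ := hmult θ hθ
    refine ⟨t / t₀, ?_⟩
    rw [ht₀]; push_cast; field_simp; linarith
  have hsq : ∃ r : ℚ, (θ₀ - μ : ℝ) ^ 2 = r := by
    choose! r hr using hmult'
    have h1 : ∑ θ ∈ Φ, (θ - μ : ℝ) ^ 2 = ((s2 - Φ.card * μ ^ 2 : ℚ) : ℝ) := by
      have : ∀ θ : ℝ, (θ - μ : ℝ) ^ 2 = θ ^ 2 - 2 * μ * θ + μ ^ 2 := fun θ => by ring
      have hlin : ∑ θ ∈ Φ, (2 * μ * θ : ℝ) = 2 * μ * ∑ θ ∈ Φ, θ := (Finset.mul_sum _ _ _).symm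
      simp only [this, Finset.sum_add_distrib, Finset.sum_sub_distrib, hlin, hsum, hs2,
        Finset.sum_const, nsmul_eq_mul]
      push_cast
      ring
    have h2 : ∑ θ ∈ Φ, (θ - μ : ℝ) ^ 2 = (∑ θ ∈ Φ, (r θ : ℝ) ^ 2) * (θ₀ - μ) ^ 2 := by
      rw [Finset.sum_mul]
      refine Finset.sum_congr rfl fun θ hθ => ?_
      conv_lhs => rw [hr θ hθ]
      ring
    have h3 : 0 < ∑ θ ∈ Φ, (r θ : ℝ) ^ 2 := by
      refine Finset.sum_pos' (fun θ _ => sq_nonneg _) ⟨θ₀, hθ₀, ?_⟩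
      have : (r θ₀ : ℝ) ≠ 0 := by
        intro h0
        have := hr θ₀ hθ₀
        rw [h0, zero_mul, add_zero] at this
        exact hirr μ this
      positivity
    refine ⟨(s2 - Φ.card * μ ^ 2) / ∑ θ ∈ Φ, (r θ) ^ 2, ?_⟩
    rw [Rat.cast_div, ← h1, h2]
    push_cast
    field_simp
  obtain ⟨r₀, hr₀⟩ := hsq
  have hroot : ∀ θ : ℝ, θ ∈ Φ ↔ aeval θ p = 0 := by
    intro θ
    rw [aeval_def, ← eval_map, hp, eval_prod, Finset.prod_eq_zero_iff]
    simp [sub_eq_zero]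
  have hconj : ∀ θ ∈ Φ, (2 * μ - θ : ℝ) ∈ Φ := by
    intro θ hθ
    obtain ⟨r, hr⟩ := hmult' θ hθ
    by_cases h0 : r = 0
    · have : θ = μ := by simpa [h0] using hr
      have h2 : (2 * μ - θ : ℝ) = θ := by rw [this]; ring
      rwa [h2]
    · have h1 := aeval_conj_eq_zero p (μ := μ) (d := r * (θ₀ - μ)) (r := r ^ 2 * r₀)
        (hd.ratCast_mul h0) (by rw [mul_pow, hr₀]; push_cast; ring)
        (by rw [← hr]; exact (hroot θ).mp hθ)
      rw [hroot]
      have h2 : (2 * μ - θ : ℝ) = μ - r * (θ₀ - μ) := by linarith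
      rw [h2]
      exact_mod_cast h1
  obtain ⟨c, hc⟩ : ∃ c : ℤ, 2 * μ = c := by
    refine exists_int_of_isIntegral ?_
    have := (hint _ hθ₀).add (hint _ (hconj _ hθ₀))
    rwa [show ((2 * μ : ℚ) : ℝ) = θ₀ + (2 * μ - θ₀) by push_cast; ring]
  have hc' : (c / 2 : ℝ) = μ := by
    have : ((2 * μ : ℚ) : ℝ) = c := by rw [hc]; simp
    push_cast at this
    linarith
  refine ⟨c, θ₀ - μ, hd, ⟨r₀, hr₀⟩, by rw [hc']; simpa using hθ₀, fun θ hθ => ⟨?_, ?_⟩⟩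
  · have : (c : ℝ) = 2 * μ := by linarith
    rw [this]
    exact hconj θ hθ
  · rw [hc']
    exact hmult' θ hθ

theorem IsArithmetic.exists_int_sq_sub {Φ : Finset ℝ} (h : IsArithmetic Φ) {θ φ : ℝ}
    (hθ : θ ∈ Φ) (hφ : φ ∈ Φ) : ∃ m : ℤ, (θ - φ) ^ 2 = m := by
  have hi := ((h.integral θ hθ).sub (h.integral φ hφ)).pow 2
  have hq : ∃ q : ℚ, (θ - φ) ^ 2 = q := by
    rcases h.dichotomy with h1 | ⟨c, d, -, ⟨r, hr⟩, -, h1⟩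
    · obtain ⟨m, rfl⟩ := h1 θ hθ
      obtain ⟨m', rfl⟩ := h1 φ hφ
      exact ⟨(m - m') ^ 2, by push_cast; ring⟩
    · obtain ⟨-, a, rfl⟩ := h1 θ hθ
      obtain ⟨-, a', rfl⟩ := h1 φ hφ
      refine ⟨(a - a') ^ 2 * r, ?_⟩
      push_cast
      rw [← hr]
      ring
  obtain ⟨q, hq⟩ := hq
  rw [hq] at hi
  obtain ⟨m, hm⟩ := exists_int_of_isIntegral hi
  exact ⟨m, by rw [hq, hm]; simp⟩

theorem IsArithmetic.one_le_abs_sub {Φ : Finset ℝ} (h : IsArithmetic Φ) {θ φ : ℝ}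
    (hθ : θ ∈ Φ) (hφ : φ ∈ Φ) (hne : θ ≠ φ) : 1 ≤ |θ - φ| := by
  obtain ⟨m, hm⟩ := h.exists_int_sq_sub hθ hφ
  have h1 : 0 < (θ - φ) ^ 2 := by have := sub_ne_zero.mpr hne; positivity
  rw [hm] at h1
  have h2 : (1 : ℤ) ≤ m := by exact_mod_cast h1
  have h3 : (1 : ℝ) ≤ (θ - φ) ^ 2 := by rw [hm]; exact_mod_cast h2
  rw [← sq_abs] at h3
  nlinarith [abs_nonneg (θ - φ)]

/-- Traces `c` and norms `e` of irrational quadratic integers all of whose conjugates lie in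
`[0, 4)`. -/
theorem trace_norm_cases {c e : ℤ} (c0 : 0 ≤ c) (c8 : c < 8) (e0 : 0 ≤ e) (e1 : 4 * e < c ^ 2)
    (e2 : 0 < 16 - 4 * c + e) (hns : ∀ m : ℤ, c ^ 2 - 4 * e ≠ m ^ 2) :
    (c = 3 ∧ e = 1) ∨ (c = 5 ∧ e = 5) ∨ (c = 4 ∧ e = 1) ∨ (c = 4 ∧ e = 2) := by
  have n1 := hns 1
  have n2 := hns 2
  have n3 := hns 3
  clear hns
  interval_cases c <;> omega

theorem exists_sq_eq_mul {a b : ℝ} {q : ℚ} {m n : ℤ} (h : a = q * b) (hm : a ^ 2 = m)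
    (hn : b ^ 2 = n) : ∃ k : ℤ, 0 ≤ k ∧ k ^ 2 = m * n := by
  have h2 : ((q * n : ℚ) : ℝ) ^ 2 = ((m * n : ℤ) : ℝ) := by
    rw [h] at hm
    push_cast
    rw [← hm, ← hn]
    ring
  have h3 : IsIntegral ℤ ((q * n : ℚ) : ℝ) := by
    refine IsIntegral.of_pow (n := 2) (by norm_num) ?_
    rw [h2]
    exact isIntegral_algebraMap (x := (m * n : ℤ))
  obtain ⟨k, hk⟩ := exists_int_of_isIntegral h3
  refine ⟨|k|, abs_nonneg k, ?_⟩
  rw [hk] at h2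
  rw [sq_abs]
  exact_mod_cast h2

/-- The possibilities for a support inside `[0, 4)`: `{0, 1, 2, 3}`, `{2, 2 ± √2}`, `{2, 2 ± √3}`,
`{(5 ± √5) / 2}`, `{(3 ± √5) / 2}` and their subsets. An irrational element is a quadratic integer
whose trace and norm are restricted by `trace_norm_cases`, and it determines the others, which lie in
the same rational line and have the same centre of symmetry. -/
theorem IsArithmetic.classification {Φ : Finset ℝ} (h : IsArithmetic Φ)
    (h0 : ∀ θ ∈ Φ, 0 ≤ θ) (h4 : ∀ θ ∈ Φ, θ < 4) :
    (∀ θ ∈ Φ, θ = 0 ∨ θ = 1 ∨ θ = 2 ∨ θ = 3) ∨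
    (∀ θ ∈ Φ, θ = 2 ∨ (θ - 2) ^ 2 = 2) ∨
    ((∀ θ ∈ Φ, θ = 2 ∨ (θ - 2) ^ 2 = 3) ∧ ∃ θ ∈ Φ, (θ - 2) ^ 2 = 3) ∨
    (∀ θ ∈ Φ, (θ - 2) ^ 2 = (θ - 2) + 1) ∨ (∀ θ ∈ Φ, (θ - 2) ^ 2 = -(θ - 2) + 1) := by
  rcases h.dichotomy with h1 | ⟨c, d, hd, ⟨r, hr⟩, hθ₀, h1⟩
  · left
    intro θ hθ
    obtain ⟨m, hm⟩ := h1 θ hθ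
    have a0 : (0 : ℤ) ≤ m := by exact_mod_cast hm ▸ h0 θ hθ
    have a4 : m < 4 := by exact_mod_cast hm ▸ h4 θ hθ
    rw [hm]
    interval_cases m <;> norm_num
  right
  -- `c` and `e` are the trace and the norm of the irrational element `c / 2 + d`
  set θ₀ : ℝ := c / 2 + d with hθ₀d
  have hθ₁ := (h1 _ hθ₀).1
  obtain ⟨e, he⟩ : ∃ e : ℤ, θ₀ * (c - θ₀) = e := by
    have hi := (h.integral _ hθ₀).mul (h.integral _ hθ₁)
    have : θ₀ * (c - θ₀) = (((c : ℚ) ^ 2 / 4 - r : ℚ) : ℝ) := by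
      push_cast; rw [← hr, hθ₀d]; ring
    rw [this] at hi
    obtain ⟨m, hm⟩ := exists_int_of_isIntegral hi
    exact ⟨m, by rw [this, hm]; simp⟩
  have b0 := h0 _ hθ₀
  have b4 := h4 _ hθ₀
  have b0' := h0 _ hθ₁
  have b4' := h4 _ hθ₁
  have hdsq : 4 * d ^ 2 = (c : ℝ) ^ 2 - 4 * e := by rw [← he, hθ₀d]; ring
  have hdpos : 0 < d ^ 2 := by have := hd.ne_zero; positivity
  have c0 : 0 ≤ c := by have : (0 : ℝ) ≤ c := by linarith
                        exact_mod_cast this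
  have c8 : c < 8 := by have : (c : ℝ) < 8 := by linarith
                        exact_mod_cast this
  have e0 : 0 ≤ e := by have : (0 : ℝ) ≤ e := by rw [← he]; positivity
                        exact_mod_cast this
  have e1 : 4 * e < c ^ 2 := by have : (4 : ℝ) * e < (c : ℝ) ^ 2 := by linarith
                                exact_mod_cast this
  have e2 : 0 < 16 - 4 * c + e := by
    have : (0 : ℝ) < 16 - 4 * c + e := by
      have := mul_pos (sub_pos.mpr b4) (sub_pos.mpr b4')
      rw [← he]; nlinarith
    exact_mod_cast this
  have hns : ∀ m : ℤ, c ^ 2 - 4 * e ≠ m ^ 2 := by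
    intro m hm
    have h2 : (2 * d) ^ 2 = (m : ℝ) ^ 2 := by
      have : ((c ^ 2 - 4 * e : ℤ) : ℝ) = ((m ^ 2 : ℤ) : ℝ) := by rw [hm]
      push_cast at this
      linarith
    rcases sq_eq_sq_iff_eq_or_eq_neg.mp h2 with h3 | h3
    · exact hd ⟨m / 2, by push_cast; linarith⟩
    · exact hd ⟨-m / 2, by push_cast; linarith⟩
  have hcases := trace_norm_cases c0 c8 e0 e1 e2 hns
  have hsquare : ∀ θ ∈ Φ, ∀ m n : ℤ, (2 * θ - c) ^ 2 = m → (2 * d) ^ 2 = n →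
      ∃ k : ℤ, 0 ≤ k ∧ k ^ 2 = m * n := by
    intro θ hθ m n hm hn
    obtain ⟨-, q, hq⟩ := h1 θ hθ
    exact exists_sq_eq_mul (q := q) (by rw [hq]; ring) hm hn
  have hlt : ∀ θ ∈ Φ, (2 * θ - c) ^ 2 < 16 := by
    intro θ hθ
    have hc1 := (h1 θ hθ).1
    have a1 := h0 _ hθ
    have a2 := h4 _ hθ
    have a3 := h0 _ hc1
    have a4 := h4 _ hc1
    rw [show (16 : ℝ) = 4 ^ 2 by norm_num]
    exact sq_lt_sq' (by linarith) (by linarith)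
  have hhalf : ∀ θ ∈ Φ, ∀ m : ℤ, 2 * θ = m → Even m := by
    intro θ hθ m hm
    have h2 := h.integral θ hθ
    rw [show θ = ((m / 2 : ℚ) : ℝ) by push_cast; linarith] at h2
    obtain ⟨k, hk⟩ := exists_int_of_isIntegral h2
    refine ⟨k, ?_⟩
    have : (m : ℚ) = k + k := by linarith
    exact_mod_cast this
  have hdisc : (2 * d) ^ 2 = ((c ^ 2 - 4 * e : ℤ) : ℝ) := by push_cast; linarith
  have hfive : Odd c → c ^ 2 - 4 * e = 5 → ∀ θ ∈ Φ, (2 * θ - c) ^ 2 = 5 := by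
    intro hodd h5 θ hθ
    rw [h5] at hdisc
    obtain ⟨m, hm⟩ := h.exists_int_sq_sub hθ (h1 θ hθ).1
    have hm' : (2 * θ - c) ^ 2 = m := by rw [← hm]; ring
    obtain ⟨k, hk0, hk⟩ := hsquare θ hθ m 5 hm' hdisc
    have m16 : m < 16 := by have := hlt θ hθ; rw [hm'] at this; exact_mod_cast this
    have m0 : 0 ≤ m := by
      have : (0 : ℝ) ≤ m := hm' ▸ sq_nonneg _
      exact_mod_cast this
    have k9 : k < 9 := by
      by_contra hk9
      have : 9 * 9 ≤ k * k := mul_self_le_mul_self (by norm_num) (not_lt.mp hk9)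
      linarith [sq k]
    have hm5 : m = 0 ∨ m = 5 := by interval_cases k <;> omega
    rcases hm5 with rfl | rfl
    · exfalso
      have : 2 * θ - c = 0 := by simpa using hm'
      exact (Int.not_even_iff_odd.mpr hodd) (hhalf θ hθ c (by linarith))
    · simpa using hm'
  have hfour : ∀ n : ℤ, (n = 2 ∨ n = 3) → c = 4 → c ^ 2 - 4 * e = 4 * n →
      ∀ θ ∈ Φ, θ = 2 ∨ (θ - 2) ^ 2 = n := by
    rintro n hn rfl hen θ hθ
    rw [hen] at hdisc
    have hq : ∃ m : ℤ, (θ - 2) ^ 2 = m := by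
      obtain ⟨-, q, hq⟩ := h1 θ hθ
      have h2 : (θ - 2) ^ 2 = ((q ^ 2 * n : ℚ) : ℝ) := by
        have : (n : ℝ) = d ^ 2 := by push_cast at hdisc; linarith
        push_cast
        rw [this, hq]
        push_cast
        ring
      have h3 := ((h.integral θ hθ).sub (isIntegral_algebraMap (R := ℤ) (A := ℝ) (x := 2))).pow 2
      rw [show algebraMap ℤ ℝ 2 = 2 by simp, h2] at h3
      obtain ⟨m, hm⟩ := exists_int_of_isIntegral h3
      exact ⟨m, by rw [h2, hm]; simp⟩
    obtain ⟨m, hm⟩ := hq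
    obtain ⟨k, hk0, hk⟩ := hsquare θ hθ (4 * m) (4 * n)
      (by push_cast; rw [← hm]; ring) hdisc
    have m4 : m < 4 := by
      have := hlt θ hθ
      have h2 : (m : ℝ) < 4 := by rw [← hm]; push_cast at this; linarith
      exact_mod_cast h2
    have m0 : 0 ≤ m := by
      have : (0 : ℝ) ≤ m := hm ▸ sq_nonneg _
      exact_mod_cast this
    have k9 : k < 13 := by
      by_contra hk9
      have : 13 * 13 ≤ k * k := mul_self_le_mul_self (by norm_num) (not_lt.mp hk9)
      rcases hn with rfl | rfl <;> linarith [sq k]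
    have hmn : m = 0 ∨ m = n := by
      rcases hn with rfl | rfl <;> interval_cases k <;> omega
    rcases hmn with rfl | rfl
    · left
      have : θ - 2 = 0 := by simpa using hm
      linarith
    · exact Or.inr hm
  rcases hcases with ⟨hc, he'⟩ | ⟨hc, he'⟩ | ⟨hc, he'⟩ | ⟨hc, he'⟩
  · refine Or.inr (Or.inr (Or.inr fun θ hθ => ?_))
    have := hfive (by rw [hc]; decide) (by rw [hc, he']; norm_num) θ hθ
    rw [hc] at this
    push_cast at this
    linarith
  · refine Or.inr (Or.inr (Or.inl fun θ hθ => ?_))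
    have := hfive (by rw [hc]; decide) (by rw [hc, he']; norm_num) θ hθ
    rw [hc] at this
    push_cast at this
    linarith
  · refine Or.inr (Or.inl ⟨fun θ hθ => ?_, θ₀, hθ₀, ?_⟩)
    · simpa using hfour 3 (Or.inr rfl) hc (by rw [hc, he']; norm_num) θ hθ
    · rw [hθ₀d]
      rw [hc, he'] at hdsq
      rw [hc]
      push_cast at hdsq ⊢
      linarith
  · refine Or.inl fun θ hθ => ?_
    simpa using hfour 2 (Or.inl rfl) hc (by rw [hc, he']; norm_num) θ hθ

/-- If `2 ± √3` meets a nonnegative support, then that support is contained in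
`{2, 2 - √3, 2 + √3}`: its centre of symmetry is `2`, so it is contained in `[0, 4]`. -/
theorem IsArithmetic.sq_sub_two_eq_three {Φ : Finset ℝ} (h : IsArithmetic Φ)
    (h0 : ∀ θ ∈ Φ, 0 ≤ θ) {θ₀ : ℝ} (hθ₀ : θ₀ ∈ Φ) (h3 : (θ₀ - 2) ^ 2 = 3) :
    ∀ θ ∈ Φ, θ = 2 ∨ (θ - 2) ^ 2 = 3 := by
  have hirr : Irrational (θ₀ - 2) := by
    refine irrational_nrt_of_notint_nrt 2 3 (by exact_mod_cast h3) ?_ (by norm_num)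
    rintro ⟨m, hm⟩
    rw [hm] at h3
    have h3' : m ^ 2 = 3 := by exact_mod_cast h3
    have a1 : m < 2 := by nlinarith
    have a2 : -2 < m := by nlinarith
    interval_cases m <;> omega
  rcases h.dichotomy with h1 | ⟨c, d, hd, ⟨r, hr⟩, -, h1⟩
  · obtain ⟨m, hm⟩ := h1 θ₀ hθ₀
    exact absurd ⟨m - 2, by rw [hm]; push_cast; ring⟩ hirr
  obtain ⟨-, q₀, hq₀⟩ := h1 θ₀ hθ₀
  have hq₀' : (q₀ : ℝ) ≠ 0 := by
    intro h2
    rw [h2, zero_mul, add_zero] at hq₀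
    exact hirr ⟨c / 2 - 2, by rw [hq₀]; push_cast; ring⟩
  have hc : (c : ℝ) = 4 := by
    by_contra hc
    have hc' : (4 - c : ℝ) ≠ 0 := fun h2 => hc (by linarith)
    have h2 : (4 - c) * (θ₀ - 2) = q₀ ^ 2 * r - 3 - (c / 2 - 2) ^ 2 := by
      rw [← hr, ← h3]
      have : q₀ * d = θ₀ - c / 2 := by linarith
      rw [← mul_pow, this]
      ring
    refine hirr ⟨(q₀ ^ 2 * r - 3 - (c / 2 - 2) ^ 2) / (4 - c), ?_⟩
    push_cast
    rw [← h2]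
    field_simp
  intro θ hθ
  obtain ⟨hθ', q, hq⟩ := h1 θ hθ
  have a0 := h0 _ hθ
  have a4 := h0 _ hθ'
  rw [hc] at a4 hq hq₀
  have hq' : θ - 2 = (q / q₀ : ℚ) * (θ₀ - 2) := by
    rw [hq, hq₀]; push_cast; field_simp; ring
  have hsq : (θ - 2) ^ 2 = (((q / q₀) ^ 2 * 3 : ℚ) : ℝ) := by
    rw [hq', mul_pow, h3]; push_cast; ring
  have hi := ((h.integral θ hθ).sub (isIntegral_algebraMap (R := ℤ) (A := ℝ) (x := 2))).pow 2
  rw [show algebraMap ℤ ℝ 2 = 2 by simp, hsq] at hi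
  obtain ⟨m, hm⟩ := exists_int_of_isIntegral hi
  -- `3 m` is the square of a rational number and `0 ≤ m ≤ 4`
  have hm' : ((3 * (q / q₀) : ℚ)) ^ 2 = 3 * m := by rw [← hm]; ring
  obtain ⟨k, hk⟩ : ∃ k : ℤ, 3 * (q / q₀) = k := by
    refine exists_int_of_isIntegral (IsIntegral.of_pow (n := 2) (by norm_num) ?_)
    have : ((3 * (q / q₀) : ℚ) : ℝ) ^ 2 = algebraMap ℤ ℝ (3 * m) := by
      rw [← Rat.cast_pow, hm']; simp
    rw [this]
    exact isIntegral_algebraMap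
  rw [hk] at hm'
  have hk' : k ^ 2 = 3 * m := by exact_mod_cast hm'
  rw [hm] at hsq
  have m4 : m ≤ 4 := by
    have : ((m : ℚ) : ℝ) ≤ 4 := by rw [← hsq]; nlinarith
    exact_mod_cast this
  have k4 : k < 4 := by nlinarith
  have k4' : -4 < k := by nlinarith
  have : m = 0 ∨ m = 3 := by interval_cases k <;> omega
  rcases this with rfl | rfl
  · left
    have : θ - 2 = 0 := by simpa using hsq
    linarith
  · exact Or.inr (by simpa using hsq)

/-! ### The signless Laplacian of a cycle with an additional edge -/

section CycleWithEdge

variable {n : ℕ}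

theorem cycle_weight (hn : 3 ≤ n) (i j : ZMod n) :
    ((WeightedGraph.cycle n).weight i j : ℝ) =
      (if j = i + 1 then 1 else 0) + (if j = i - 1 then 1 else 0) := by
  have h1 : (1 : ZMod n) ≠ 0 := by
    have : ((1 : ℕ) : ZMod n) ≠ 0 := by
      rw [Ne, ZMod.natCast_eq_zero_iff]
      exact fun h => absurd (Nat.le_of_dvd one_pos h) (by omega)
    simpa using this
  have h2 : (2 : ZMod n) ≠ 0 := by
    have : ((2 : ℕ) : ZMod n) ≠ 0 := by
      rw [Ne, ZMod.natCast_eq_zero_iff]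
      exact fun h => absurd (Nat.le_of_dvd two_pos h) (by omega)
    simpa using this
  simp only [WeightedGraph.cycle, WeightedGraph.ofSimpleGraph,
    SimpleGraph.circulantGraph_adj, Set.mem_singleton_iff]
  by_cases ha : j = i + 1
  · have hb : i + 1 ≠ i - 1 := fun h => h2 (by linear_combination h)
    subst ha
    simp [hb, h1]
  · by_cases hb : j = i - 1
    · subst hb
      have hc : i - 1 ≠ i + 1 := fun h => h2 (by linear_combination -h)
      have hd : i ≠ i - 1 := fun h => h1 (by linear_combination h)
      simp [hc, hd]
    · have hc : ¬ (i - j = 1) := fun h => hb (by linear_combination -h)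
      have hd : ¬ (j - i = 1) := fun h => ha (by linear_combination h)
      simp [ha, hb, hc, hd]

variable {b : ZMod n} {hb : b ≠ 0} {ρ : ℕ}

theorem addEdge_weight (hn : 3 ≤ n) (i j : ZMod n) :
    (((WeightedGraph.cycle n).addEdge 0 b hb.symm (ρ : ℝ≥0)).weight i j : ℝ) =
      (if j = i + 1 then 1 else 0) + (if j = i - 1 then 1 else 0) +
      ((if i = 0 then (if j = b then (ρ : ℝ) else 0) else 0) +
        (if i = b then (if j = 0 then (ρ : ℝ) else 0) else 0)) := by
  simp only [WeightedGraph.addEdge, NNReal.coe_add, cycle_weight hn]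
  congr 1
  by_cases h0 : i = 0
  · subst h0
    by_cases hj : j = b
    · subst hj; simp [hb.symm]
    · simp [hj, hb.symm]
  · by_cases h1 : i = b
    · subst h1
      by_cases hj : j = 0
      · subst hj; simp [hb, Sym2.eq_swap]
      · simp [hj, hb]
    · simp [h0, h1]

variable [NeZero n]

/-- The signless Laplacian of `C_n + ρ {0, b}`. -/
noncomputable def cycleEdgeQ (b : ZMod n) (hb : b ≠ 0) (ρ : ℕ) : Matrix (ZMod n) (ZMod n) ℝ :=
  ((WeightedGraph.cycle n).addEdge 0 b hb.symm (ρ : ℝ≥0)).signlessLaplacian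

theorem cycleEdgeQ_mulVec (hn : 3 ≤ n) (y : ZMod n → ℝ) (i : ZMod n) :
    (cycleEdgeQ b hb ρ *ᵥ y) i = 2 * y i + y (i + 1) + y (i - 1) +
      ((if i = 0 then ρ * (y 0 + y b) else 0) + (if i = b then ρ * (y 0 + y b) else 0)) := by
  have h1 : (cycleEdgeQ b hb ρ *ᵥ y) i = ∑ j,
      (((WeightedGraph.cycle n).addEdge 0 b hb.symm (ρ : ℝ≥0)).weight i j : ℝ) * (y i + y j) := by
    simp only [cycleEdgeQ, WeightedGraph.signlessLaplacian, WeightedGraph.degMatrix,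
      WeightedGraph.adjMatrix, Matrix.add_mulVec, Matrix.mulVec_diagonal, Pi.add_apply,
      Matrix.of_apply, mul_add, Finset.sum_add_distrib, Finset.sum_mul]
    rfl
  rw [h1]
  simp only [addEdge_weight (hb := hb) hn, add_mul, Finset.sum_add_distrib, ite_mul, one_mul, zero_mul,
    Finset.sum_ite_eq', Finset.mem_univ, if_true]
  have h2 : ∀ (p : Prop) [Decidable p] (c : ZMod n),
      (∑ x, if p then (if x = c then (ρ : ℝ) * (y i + y x) else 0) else 0) =
        if p then (ρ : ℝ) * (y i + y c) else 0 := by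
    intro p _ c
    split_ifs <;> simp
  rw [h2, h2]
  by_cases h0 : i = 0
  · subst h0
    simp [hb.symm]; ring
  · by_cases h3 : i = b
    · subst h3
      simp [hb]; ring
    · simp [h0, h3]; ring

theorem cycleEdgeQ_transpose : (cycleEdgeQ b hb ρ)ᵀ = cycleEdgeQ b hb ρ := by
  simp only [cycleEdgeQ, WeightedGraph.signlessLaplacian, WeightedGraph.degMatrix,
    Matrix.transpose_add, Matrix.diagonal_transpose]
  congr 1
  ext i j
  simp [WeightedGraph.adjMatrix, WeightedGraph.symm _ i j]

theorem exists_int_cycleEdgeQ (hn : 3 ≤ n) : ∃ N : Matrix (ZMod n) (ZMod n) ℤ,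
    cycleEdgeQ b hb ρ = N.map (Int.castRingHom ℝ) := by
  have h : ∀ i j, ∃ m : ℤ, cycleEdgeQ b hb ρ i j = m := by
    intro i j
    have h1 := cycleEdgeQ_mulVec (hb := hb) (ρ := ρ) hn (Pi.single j 1) i
    rw [Matrix.mulVec_single_one, Matrix.col_apply] at h1
    have hs : ∀ k, (Pi.single j 1 : ZMod n → ℝ) k = ((if k = j then 1 else 0 : ℤ) : ℝ) := by
      intro k
      simp [Pi.single_apply]
    simp only [hs] at h1
    refine ⟨2 * (if i = j then 1 else 0) + (if i + 1 = j then 1 else 0) +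
      (if i - 1 = j then 1 else 0) +
      ((if i = 0 then (ρ : ℤ) * ((if 0 = j then 1 else 0) + (if b = j then 1 else 0)) else 0) +
      (if i = b then (ρ : ℤ) * ((if 0 = j then 1 else 0) + (if b = j then 1 else 0)) else 0)), ?_⟩
    rw [h1]
    push_cast
    rfl
  choose N hN using h
  exact ⟨Matrix.of N, by ext i j; simp [hN]⟩

/-! ### Quadratic forms and bounds on eigenvalues -/

theorem sum_shift (f : ZMod n → ℝ) : ∑ i, f (i + 1) = ∑ i, f i :=
  Equiv.sum_comp (Equiv.addRight (1 : ZMod n)) f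

theorem dotProduct_cycleEdgeQ_mulVec (hn : 3 ≤ n) (w y : ZMod n → ℝ) :
    w ⬝ᵥ (cycleEdgeQ b hb ρ *ᵥ y) =
      ∑ i, (w i + w (i + 1)) * (y i + y (i + 1)) + ρ * ((w 0 + w b) * (y 0 + y b)) := by
  simp only [dotProduct, cycleEdgeQ_mulVec hn, mul_add, Finset.sum_add_distrib, mul_ite, mul_zero,
    Finset.sum_ite_eq', Finset.mem_univ, if_true, add_mul]
  have h1 : ∑ i, w i * y (i - 1) = ∑ i, w (i + 1) * y i := by
    rw [← sum_shift]
    simp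
  have h2 := sum_shift fun i => w i * y i
  rw [h1, h2]
  have h3 : ∑ i, w i * (2 * y i) = 2 * ∑ i, w i * y i := by
    rw [Finset.mul_sum]
    exact Finset.sum_congr rfl fun i _ => by ring
  rw [h3]
  ring

theorem dotProduct_self_pos {w : ZMod n → ℝ} (hw0 : w ≠ 0) : 0 < w ⬝ᵥ w := by
  rw [← Matrix.dotProduct_self_star_pos_iff] at hw0
  simpa using hw0

theorem eigenvalue_nonneg (hn : 3 ≤ n) {w : ZMod n → ℝ} (hw0 : w ≠ 0) {θ : ℝ}
    (hw : cycleEdgeQ b hb ρ *ᵥ w = θ • w) : 0 ≤ θ := by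
  have h1 := dotProduct_cycleEdgeQ_mulVec (hb := hb) (ρ := ρ) hn w w
  rw [hw, dotProduct_smul, smul_eq_mul] at h1
  have h2 := dotProduct_self_pos hw0
  have h3 : 0 ≤ θ * (w ⬝ᵥ w) := by
    rw [h1]
    refine add_nonneg (Finset.sum_nonneg fun i _ => mul_self_nonneg _) ?_
    exact mul_nonneg (Nat.cast_nonneg _) (mul_self_nonneg _)
  exact nonneg_of_mul_nonneg_left h3 h2

/-- On vectors with `w 0 + w b = 0` the additional edge is invisible and the form is at most four
times the square of the norm, the defect being the Laplacian form of the cycle. -/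
theorem four_mul_dotProduct_self (hn : 3 ≤ n) {w : ZMod n → ℝ} (h0 : w 0 + w b = 0) :
    4 * (w ⬝ᵥ w) = w ⬝ᵥ (cycleEdgeQ b hb ρ *ᵥ w) + ∑ i, (w i - w (i + 1)) ^ 2 := by
  rw [dotProduct_cycleEdgeQ_mulVec hn, h0, mul_zero, mul_zero, add_zero, ← Finset.sum_add_distrib]
  have h2 := sum_shift fun i => w i * w i
  have h3 : 4 * (w ⬝ᵥ w) = ∑ i, (2 * (w i * w i)) + ∑ i, 2 * (w (i + 1) * w (i + 1)) := by
    rw [← Finset.mul_sum, ← Finset.mul_sum, h2, dotProduct]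
    ring
  rw [h3, ← Finset.sum_add_distrib]
  exact Finset.sum_congr rfl fun i _ => by ring

/-- The additional edge is a perturbation of rank one, so it pushes at most one eigenvalue
above `4`. -/
theorem eigenvalue_gt_four_unique (hn : 3 ≤ n) {w w' : ZMod n → ℝ} (hw0 : w ≠ 0) (hw0' : w' ≠ 0)
    {θ θ' : ℝ} (hw : cycleEdgeQ b hb ρ *ᵥ w = θ • w) (hw' : cycleEdgeQ b hb ρ *ᵥ w' = θ' • w')
    (hθ : 4 < θ) (hθ' : 4 < θ') : θ = θ' := by
  by_contra hne
  have horth : w ⬝ᵥ w' = 0 := by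
    have h1 : w ⬝ᵥ (cycleEdgeQ b hb ρ *ᵥ w') = (cycleEdgeQ b hb ρ *ᵥ w) ⬝ᵥ w' := by
      rw [Matrix.dotProduct_mulVec, ← Matrix.mulVec_transpose, cycleEdgeQ_transpose]
    rw [hw, hw', dotProduct_smul, smul_dotProduct, smul_eq_mul, smul_eq_mul] at h1
    by_contra h2
    exact hne (mul_right_cancel₀ h2 h1).symm
  have horth' : w' ⬝ᵥ w = 0 := by rw [dotProduct_comm, horth]
  have hc : ∀ {w : ZMod n → ℝ} {θ : ℝ}, w ≠ 0 → cycleEdgeQ b hb ρ *ᵥ w = θ • w → 4 < θ →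
      w 0 + w b ≠ 0 := by
    intro w θ hw0 hw hθ h0
    have h1 := four_mul_dotProduct_self (hb := hb) (ρ := ρ) hn h0
    rw [hw, dotProduct_smul, smul_eq_mul] at h1
    have h2 := dotProduct_self_pos hw0
    have h3 : 0 ≤ ∑ i, (w i - w (i + 1)) ^ 2 := Finset.sum_nonneg fun i _ => sq_nonneg _
    nlinarith
  set c := w 0 + w b with hcd
  set c' := w' 0 + w' b with hcd'
  have hc1 := hc hw0 hw hθ
  have hc2 := hc hw0' hw' hθ'
  have h1 := four_mul_dotProduct_self (hb := hb) (ρ := ρ) hn (w := c' • w - c • w') (by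
    simp only [Pi.sub_apply, Pi.smul_apply, smul_eq_mul]
    rw [show c' * w 0 - c * w' 0 + (c' * w b - c * w' b) =
      c' * (w 0 + w b) - c * (w' 0 + w' b) by ring, ← hcd, ← hcd']
    ring)
  rw [Matrix.mulVec_sub, Matrix.mulVec_smul, Matrix.mulVec_smul, hw, hw'] at h1
  simp only [dotProduct_sub, sub_dotProduct, dotProduct_smul, smul_dotProduct, smul_eq_mul, horth,
    horth', mul_zero, sub_zero, zero_sub] at h1
  have h2 := dotProduct_self_pos hw0
  have h2' := dotProduct_self_pos hw0'
  have h3 : 0 ≤ ∑ i, ((c' • w - c • w') i - (c' • w - c • w') (i + 1)) ^ 2 :=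
    Finset.sum_nonneg fun i _ => sq_nonneg _
  have h4 : 0 < c' ^ 2 * (w ⬝ᵥ w) * (θ - 4) :=
    mul_pos (mul_pos (by positivity) h2) (by linarith)
  have h5 : 0 < c ^ 2 * (w' ⬝ᵥ w') * (θ' - 4) :=
    mul_pos (mul_pos (by positivity) h2') (by linarith)
  nlinarith

/-- If `b = 2 k`, then a walk of even length in the cycle together with the additional edge closes up
to an odd walk, so the graph is not bipartite and `0` is not an eigenvalue. -/
theorem eigenvalue_ne_zero (hn : 3 ≤ n) (hρ : 0 < ρ) {k : ZMod n} (hbk : b = 2 * k)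
    {w : ZMod n → ℝ} (hw0 : w ≠ 0) {θ : ℝ}
    (hw : cycleEdgeQ b hb ρ *ᵥ w = θ • w) : θ ≠ 0 := by
  rintro rfl
  have h1 := dotProduct_cycleEdgeQ_mulVec (hb := hb) (ρ := ρ) hn w w
  rw [hw, zero_smul, dotProduct_zero] at h1
  have h2 : 0 ≤ ∑ i, (w i + w (i + 1)) * (w i + w (i + 1)) :=
    Finset.sum_nonneg fun i _ => mul_self_nonneg _
  have h3 : 0 ≤ (ρ : ℝ) * ((w 0 + w b) * (w 0 + w b)) :=
    mul_nonneg (Nat.cast_nonneg _) (mul_self_nonneg _)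
  have h4 : ∑ i, (w i + w (i + 1)) * (w i + w (i + 1)) = 0 := by linarith
  have h5 : (ρ : ℝ) * ((w 0 + w b) * (w 0 + w b)) = 0 := by linarith
  have h6 : w 0 + w b = 0 := by
    have : (ρ : ℝ) ≠ 0 := by exact_mod_cast hρ.ne'
    simpa [this] using h5
  have h7 : ∀ i, w (i + 1) = - w i := by
    intro i
    have := (Finset.sum_eq_zero_iff_of_nonneg fun i _ => mul_self_nonneg _).mp h4 i
      (Finset.mem_univ i)
    have := mul_self_eq_zero.mp this
    linarith
  have h8 : ∀ j : ℕ, w (2 * (j : ZMod n)) = w 0 := by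
    intro j
    induction j with
    | zero => simp
    | succ j ih =>
      rw [show (2 * ((j + 1 : ℕ) : ZMod n)) = 2 * (j : ZMod n) + 1 + 1 by push_cast; ring, h7, h7,
        ih, neg_neg]
  have h9 : w b = w 0 := by
    rw [hbk, ← ZMod.natCast_zmod_val k]
    exact h8 _
  have h10 : w 0 = 0 := by linarith
  have h11 : ∀ j : ℕ, w (j : ZMod n) = 0 := by
    intro j
    induction j with
    | zero => simpa using h10
    | succ j ih => rw [Nat.cast_succ, h7, ih, neg_zero]
  refine hw0 (funext fun i => ?_)
  rw [← ZMod.natCast_zmod_val i]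
  exact h11 _

end CycleWithEdge

/-! ### Vectors that a reflection negates -/

section Reflection

variable {n : ℕ} {b : ZMod n} {hb : b ≠ 0} {ρ : ℕ}

/-- The reflection `i ↦ r - i` of the cycle maps the pair `{0, b}` to itself, either exchanging the
two points or, which needs them to be antipodal, fixing both. -/
def PreservesEdge (b r : ZMod n) : Prop := r = b ∨ (r = 0 ∧ b + b = 0)

/-- The reflection `i ↦ r - i` negates `y`. -/
def IsAntisymm (r : ZMod n) (y : ZMod n → ℝ) : Prop := ∀ i, y (r - i) = -y i

theorem IsAntisymm.apply_zero_add {r : ZMod n} (hr : PreservesEdge b r) {y : ZMod n → ℝ}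
    (hy : IsAntisymm r y) : y 0 + y b = 0 := by
  rcases hr with rfl | ⟨rfl, hbb⟩
  · have := hy 0
    rw [sub_zero] at this
    linarith
  · have h1 := hy 0
    have h2 := hy b
    rw [zero_sub, show -b = b by linear_combination -hbb] at h2
    rw [sub_zero] at h1
    linarith

variable [NeZero n]

/-- The permutation matrix of the reflection `i ↦ r - i`. -/
noncomputable def reflection (r : ZMod n) : Matrix (ZMod n) (ZMod n) ℝ :=
  Matrix.of fun i j => if j = r - i then 1 else 0

theorem reflection_mulVec (r : ZMod n) (y : ZMod n → ℝ) (i : ZMod n) :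
    (reflection r *ᵥ y) i = y (r - i) := by
  simp [reflection, Matrix.mulVec, dotProduct]

theorem commute_reflection (hn : 3 ≤ n) {r : ZMod n} (hr : PreservesEdge b r) :
    Commute (cycleEdgeQ b hb ρ) (reflection r) := by
  refine Matrix.ext_of_mulVec_single fun j => ?_
  generalize (Pi.single j 1 : ZMod n → ℝ) = y
  funext i
  rw [← Matrix.mulVec_mulVec, ← Matrix.mulVec_mulVec, cycleEdgeQ_mulVec hn, reflection_mulVec,
    reflection_mulVec, reflection_mulVec, reflection_mulVec, reflection_mulVec, reflection_mulVec,
    cycleEdgeQ_mulVec hn, show r - (i + 1) = r - i - 1 by ring,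
    show r - (i - 1) = r - i + 1 by ring]
  rcases hr with rfl | ⟨rfl, hbb⟩
  · have e1 : r - i = 0 ↔ i = r := by rw [sub_eq_zero, eq_comm]
    have e2 : r - i = r ↔ i = 0 := by rw [sub_eq_self]
    simp only [e1, e2, sub_zero, sub_self, add_comm (y r) (y 0)]
    ring
  · have hneg : -b = b := by linear_combination -hbb
    have e1 : -i = 0 ↔ i = 0 := neg_eq_zero
    have e2 : -i = b ↔ i = b := by rw [neg_eq_iff_eq_neg, hneg]
    simp only [e1, e2, zero_sub, neg_zero, hneg]
    ring

/-- On antisymmetric vectors the additional edge is invisible. -/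
theorem IsAntisymm.mulVec (hn : 3 ≤ n) {r : ZMod n} (hr : PreservesEdge b r) {y : ZMod n → ℝ}
    (hy : IsAntisymm r y) :
    cycleEdgeQ b hb ρ *ᵥ y = fun i => 2 * y i + y (i + 1) + y (i - 1) := by
  funext i
  rw [cycleEdgeQ_mulVec hn, hy.apply_zero_add hr]
  simp

theorem IsAntisymm.aeval (hn : 3 ≤ n) {r : ZMod n} (hr : PreservesEdge b r) {y : ZMod n → ℝ}
    (hy : IsAntisymm r y) (p : ℝ[X]) :
    IsAntisymm r (Polynomial.aeval (cycleEdgeQ b hb ρ) p *ᵥ y) := by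
  have hc : Commute (Polynomial.aeval (cycleEdgeQ b hb ρ) p) (reflection r) := by
    rw [aeval_eq_sum_range]
    exact Commute.sum_left _ _ _ fun i _ =>
      (((commute_reflection hn hr).pow_left i).smul_left _)
  have hy' : reflection r *ᵥ y = -y := by
    funext i
    rw [reflection_mulVec, hy i, Pi.neg_apply]
  intro i
  rw [← reflection_mulVec r (Polynomial.aeval (cycleEdgeQ b hb ρ) p *ᵥ y) i, Matrix.mulVec_mulVec,
    ← hc.eq, ← Matrix.mulVec_mulVec, hy', Matrix.mulVec_neg, Pi.neg_apply]

/-- Eigenvectors in the span of an antisymmetric vector are antisymmetric, so their eigenvalues are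
those of the cycle, and the constant vector, the only one for `4`, is excluded. -/
theorem IsAntisymm.lt_four (hn : 3 ≤ n) {r : ZMod n} (hr : PreservesEdge b r) {y : ZMod n → ℝ}
    (hy : IsAntisymm r y) {θ : ℝ} (hθ : θ ∈ spectralSupport (cycleEdgeQ b hb ρ) y) : θ < 4 := by
  obtain ⟨p, hp0, hp⟩ := exists_eigenvector_of_mem_spectralSupport cycleEdgeQ_transpose hθ
  have hw := hy.aeval (hb := hb) (ρ := ρ) hn hr p
  set w := Polynomial.aeval (cycleEdgeQ b hb ρ) p *ᵥ y with hwd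
  have h1 := four_mul_dotProduct_self (hb := hb) (ρ := ρ) hn (hw.apply_zero_add hr)
  rw [hp, dotProduct_smul, smul_eq_mul] at h1
  have h2 := dotProduct_self_pos hp0
  have h3 : 0 ≤ ∑ i, (w i - w (i + 1)) ^ 2 := Finset.sum_nonneg fun i _ => sq_nonneg _
  by_contra h4
  have h5 : ∑ i, (w i - w (i + 1)) ^ 2 = 0 := by nlinarith
  -- an eigenvector for the eigenvalue `4` is constant, and an antisymmetric constant vanishes
  have h6 : ∀ i, w (i + 1) = w i := by
    intro i
    have := (Finset.sum_eq_zero_iff_of_nonneg fun i _ => sq_nonneg _).mp h5 i (Finset.mem_univ i)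
    have := pow_eq_zero_iff (two_ne_zero) |>.mp this
    linarith
  have h7 : ∀ j : ℕ, w (j : ZMod n) = w 0 := by
    intro j
    induction j with
    | zero => simp
    | succ j ih => rw [Nat.cast_succ, h6, ih]
  have h8 : ∀ i, w i = w 0 := fun i => by rw [← ZMod.natCast_zmod_val i]; exact h7 _
  have h9 := hw 0
  rw [h8 (r - 0)] at h9
  exact hp0 (funext fun i => by rw [h8 i, Pi.zero_apply]; linarith)

/-- On antisymmetric vectors `Q - 2 = S + S⁻¹` with the cyclic shift `S`, and the Chebyshev
polynomials give `C_j (S + S⁻¹) = S ^ j + S ^ (-j)`. -/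
theorem IsAntisymm.aeval_chebyshev (hn : 3 ≤ n) {r : ZMod n} (hr : PreservesEdge b r)
    {y : ZMod n → ℝ} (hy : IsAntisymm r y) (j : ℕ) :
    Polynomial.aeval (cycleEdgeQ b hb ρ) ((Chebyshev.C ℝ j).comp (X - C 2)) *ᵥ y =
      fun i => y (i + j) + y (i - j) := by
  induction j using Nat.twoStepInduction with
  | zero =>
    funext i
    simp only [Nat.cast_zero, Chebyshev.C_zero, ofNat_comp, map_ofNat, add_zero, sub_zero]
    rw [show (((2 : ℕ) : ℝ[X])) = C 2 from (map_ofNat C 2).symm, aeval_C, Algebra.algebraMap_eq_smul_one,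
      Matrix.smul_mulVec, Matrix.one_mulVec]
    simp [two_mul]
  | one =>
    funext i
    simp only [Nat.cast_one, Chebyshev.C_one, X_comp, map_sub, aeval_X, aeval_C,
      Matrix.sub_mulVec, Algebra.algebraMap_eq_smul_one, Matrix.smul_mulVec, Matrix.one_mulVec,
      hy.mulVec hn hr, Pi.sub_apply, Pi.smul_apply, smul_eq_mul]
    ring
  | more j ih1 ih2 =>
    have hz := hy.aeval (hb := hb) (ρ := ρ) hn hr ((Chebyshev.C ℝ (j + 1 : ℕ)).comp (X - C 2))
    have h1 : (Chebyshev.C ℝ (j + 2 : ℕ)).comp (X - C 2) =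
        (X - C 2) * (Chebyshev.C ℝ (j + 1 : ℕ)).comp (X - C 2) -
          (Chebyshev.C ℝ j).comp (X - C 2) := by
      push_cast
      rw [Chebyshev.C_add_two, sub_comp, mul_comp, X_comp]
    rw [h1, map_sub, map_mul, Matrix.sub_mulVec, ih1, ← Matrix.mulVec_mulVec]
    rw [ih2] at hz ⊢
    funext i
    simp only [map_sub, aeval_X, aeval_C, Matrix.sub_mulVec, Algebra.algebraMap_eq_smul_one,
      Matrix.smul_mulVec, Matrix.one_mulVec, hz.mulVec hn hr, Pi.sub_apply, Pi.smul_apply,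
      smul_eq_mul]
    push_cast
    rw [show i + 1 + ((j : ZMod n) + 1) = i + (j + 2) by ring,
      show i + 1 - ((j : ZMod n) + 1) = i - j by ring,
      show i - 1 + ((j : ZMod n) + 1) = i + j by ring,
      show i - 1 - ((j : ZMod n) + 1) = i - (j + 2) by ring]
    ring

theorem aeval_comp_mulVec_eq_zero {Q : Matrix (ZMod n) (ZMod n) ℝ} (hQ : Qᵀ = Q)
    {y : ZMod n → ℝ} {p : ℝ[X]} (h : ∀ θ ∈ spectralSupport Q y, p.eval (θ - 2) = 0) :
    Polynomial.aeval Q (p.comp (X - C 2)) *ᵥ y = 0 := by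
  rw [aeval_mulVec_eq_zero_iff hQ]
  intro θ hθ
  simpa using h θ hθ

/-- A second difference with step `L` that vanishes on the whole cyclic group forces period `L`. -/
theorem periodic_of_second_difference {y : ZMod n → ℝ} {L : ZMod n}
    (h : ∀ i, y (i + L) + y (i - L) = 2 * y i) (i : ZMod n) : y (i + L) = y i := by
  have h1 : ∀ j : ℕ, y (i + j * L) = y i + j * (y (i + L) - y i) := by
    intro j
    induction j using Nat.twoStepInduction with
    | zero => simp
    | one => simp
    | more j ih1 ih2 =>
      have h2 := h (i + (j + 1 : ℕ) * L)
      rw [show i + ((j + 1 : ℕ) : ZMod n) * L - L = i + j * L by push_cast; ring,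
        show i + ((j + 1 : ℕ) : ZMod n) * L + L = i + (j + 2 : ℕ) * L by push_cast; ring,
        ih1, ih2] at h2
      push_cast at h2 ⊢
      linarith
  have h2 := h1 n
  have hn : (n : ℝ) ≠ 0 := by exact_mod_cast NeZero.ne n
  simp only [CharP.cast_eq_zero, zero_mul, add_zero, left_eq_add, mul_eq_zero, hn, false_or] at h2
  linarith

theorem eval_chebyshev_two_mul (j : ℤ) (t : ℝ) :
    (Chebyshev.C ℝ (2 * j)).eval t = (Chebyshev.C ℝ j).eval t ^ 2 - 2 := by
  rw [Chebyshev.C_mul, eval_comp, Chebyshev.C_two]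
  simp

theorem eval_chebyshev_three_mul (j : ℤ) (t : ℝ) :
    (Chebyshev.C ℝ (3 * j)).eval t =
      (Chebyshev.C ℝ j).eval t ^ 3 - 3 * (Chebyshev.C ℝ j).eval t := by
  rw [Chebyshev.C_mul, eval_comp, show (3 : ℤ) = 1 + 2 by norm_num, Chebyshev.C_add_two]
  norm_num [Chebyshev.C_two]
  ring

theorem eval_chebyshev_five (t : ℝ) :
    (Chebyshev.C ℝ 5).eval t = t ^ 5 - 5 * t ^ 3 + 5 * t := by
  have h3 := eval_chebyshev_three_mul 1 t
  have h4 := eval_chebyshev_two_mul 2 t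
  rw [show (5 : ℤ) = 3 + 2 by norm_num, Chebyshev.C_add_two]
  norm_num [Chebyshev.C_two] at h3 h4 ⊢
  rw [h3, h4]
  ring

/-- A relation `∑ a_j C_j (θ - 2) = a` on the support gives a recurrence for `y`. -/
theorem IsAntisymm.recurrence (hn : 3 ≤ n) {r : ZMod n} (hr : PreservesEdge b r)
    {y : ZMod n → ℝ} (hy : IsAntisymm r y) {s : Finset ℕ} {a : ℕ → ℝ}
    (h : ∀ θ ∈ spectralSupport (cycleEdgeQ b hb ρ) y,
      ∑ j ∈ s, a j * (Chebyshev.C ℝ j).eval (θ - 2) = 0) (i : ZMod n) :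
    ∑ j ∈ s, a j * (y (i + j) + y (i - j)) = 0 := by
  have h1 := aeval_comp_mulVec_eq_zero (cycleEdgeQ_transpose (hb := hb) (ρ := ρ)) (y := y)
    (p := ∑ j ∈ s, C (a j) * Chebyshev.C ℝ j) (by
      intro θ hθ
      simpa [eval_finsetSum] using h θ hθ)
  have h2 := congrFun h1 i
  simpa [Polynomial.sum_comp, Matrix.sum_mulVec, Algebra.algebraMap_eq_smul_one,
    Matrix.smul_mulVec, hy.aeval_chebyshev hn hr] using h2

/-- The recurrences of an antisymmetric vector with arithmetic support, in the order of
`IsArithmetic.classification`; both cases with `√5` have period `10`. The period is the common order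
of the numbers `ζ` with `ζ + ζ⁻¹ = θ - 2`. -/
theorem IsAntisymm.periods (hn : 3 ≤ n) {r : ZMod n} (hr : PreservesEdge b r)
    {y : ZMod n → ℝ} (hy : IsAntisymm r y) {Φ : Finset ℝ}
    (hΦ : (Φ : Set ℝ) = spectralSupport (cycleEdgeQ b hb ρ) y) (harith : IsArithmetic Φ) :
    ((∀ i, y (i + 12) = y i) ∧
      ∀ i, y (i + 6) + y (i - 6) + (y (i + 4) + y (i - 4)) - (y (i + 2) + y (i - 2)) = 2 * y i) ∨
    (∀ i, y (i + 8) = y i) ∨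
    ((∀ i, y (i + 12) = y i) ∧ (∀ i, y (i + 3) + y (i - 3) = 0) ∧
      ∃ θ ∈ spectralSupport (cycleEdgeQ b hb ρ) y, (θ - 2) ^ 2 = 3) ∨
    (∀ i, y (i + 10) = y i) := by
  have hmem : ∀ θ, θ ∈ Φ ↔ θ ∈ spectralSupport (cycleEdgeQ b hb ρ) y := fun θ => by
    rw [← hΦ]; simp
  have hnonneg : ∀ θ ∈ Φ, 0 ≤ θ := by
    intro θ hθ
    obtain ⟨w, hw, hwy⟩ := (hmem θ).mp hθ
    exact eigenvalue_nonneg hn (fun h => hwy (by rw [h, zero_dotProduct])) hw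
  have hlt : ∀ θ ∈ Φ, θ < 4 := fun θ hθ => hy.lt_four hn hr ((hmem θ).mp hθ)
  have hper : ∀ L : ℕ, 0 < L → (∀ θ ∈ Φ, (Chebyshev.C ℝ L).eval (θ - 2) = 2) →
      ∀ i, y (i + L) = y i := by
    intro L hL h
    refine periodic_of_second_difference fun i => ?_
    have := hy.recurrence (hb := hb) (ρ := ρ) hn hr (s := {0, L})
      (a := fun j => if j = 0 then -1 else 1) (fun θ hθ => by
        rw [Finset.sum_pair hL.ne]
        simp [hL.ne', h θ ((hmem θ).mpr hθ)]) i
    rw [Finset.sum_pair hL.ne] at this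
    simp [hL.ne'] at this
    linarith
  have c2 := fun t : ℝ => eval_chebyshev_two_mul 1 t
  have c3 := fun t : ℝ => eval_chebyshev_three_mul 1 t
  have c4 := fun t : ℝ => eval_chebyshev_two_mul 2 t
  have c6 := fun t : ℝ => eval_chebyshev_three_mul 2 t
  have c8 := fun t : ℝ => eval_chebyshev_two_mul 4 t
  have c10 := fun t : ℝ => eval_chebyshev_two_mul 5 t
  have c12 := fun t : ℝ => eval_chebyshev_three_mul 4 t
  norm_num at c2 c3 c4 c6 c8 c10 c12
  rcases harith.classification hnonneg hlt with h | h | ⟨h, θ₀, hθ₀, hθ₀'⟩ | h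
  · left
    constructor
    · have := hper 12 (by norm_num) (fun θ hθ => by
        push_cast
        rw [c12, c4, c2]
        rcases h θ hθ with rfl | rfl | rfl | rfl <;> norm_num)
      exact_mod_cast this
    · -- `(Y ^ 2 - 4) (Y + 1) = C_6 + C_4 - C_2 - 2` with `Y = C_2` vanishes on `{-2, -1, 0, 1}`
      intro i
      have := hy.recurrence (hb := hb) (ρ := ρ) hn hr (s := {0, 2, 4, 6})
        (a := fun j => if j = 0 ∨ j = 2 then -1 else 1) (fun θ hθ => by
          rw [Finset.sum_insert (by decide), Finset.sum_insert (by decide),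
            Finset.sum_pair (by decide)]
          norm_num
          rw [c6, c4, c2]
          rcases h θ ((hmem θ).mpr hθ) with rfl | rfl | rfl | rfl <;> norm_num) i
      rw [Finset.sum_insert (by decide), Finset.sum_insert (by decide),
        Finset.sum_pair (by decide)] at this
      norm_num at this
      linarith
  · right; left
    have := hper 8 (by norm_num) (fun θ hθ => by
      push_cast
      rw [c8, c4, c2]
      rcases h θ hθ with rfl | h2
      · norm_num
      · rw [h2]; norm_num)
    exact_mod_cast this
  · right; right; left
    refine ⟨?_, ?_, θ₀, (hmem _).mp hθ₀, hθ₀'⟩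
    · have := hper 12 (by norm_num) (fun θ hθ => by
        push_cast
        rw [c12, c4, c2]
        rcases h θ hθ with rfl | h2
        · norm_num
        · rw [h2]; norm_num)
      exact_mod_cast this
    · intro i
      have := hy.recurrence (hb := hb) (ρ := ρ) hn hr (s := {3}) (a := fun _ => 1)
        (fun θ hθ => by
          rw [Finset.sum_singleton]
          push_cast
          rw [c3, one_mul]
          rcases h θ ((hmem θ).mpr hθ) with rfl | h2
          · norm_num
          · linear_combination (θ - 2) * h2) i
      simpa using this
  · right; right; right
    have h5 : ∀ θ ∈ Φ, ((Chebyshev.C ℝ 5).eval (θ - 2)) ^ 2 = 4 := by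
      intro θ hθ
      rw [eval_chebyshev_five]
      rcases h with h | h
      · have h2 := h θ hθ
        have : (θ - 2) ^ 5 - 5 * (θ - 2) ^ 3 + 5 * (θ - 2) = -2 := by
          linear_combination ((θ - 2) ^ 3 + (θ - 2) ^ 2 - 3 * (θ - 2) - 2) * h2
        rw [this]; norm_num
      · have h2 := h θ hθ
        have : (θ - 2) ^ 5 - 5 * (θ - 2) ^ 3 + 5 * (θ - 2) = 2 := by
          linear_combination ((θ - 2) ^ 3 - (θ - 2) ^ 2 - 3 * (θ - 2) + 2) * h2
        rw [this]; norm_num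
    have := hper 10 (by norm_num) (fun θ hθ => by
      push_cast
      rw [c10, h5 θ hθ]
      norm_num)
    exact_mod_cast this

end Reflection

/-! ### Pair states -/

section Pair

variable {n : ℕ}

/-- The integer vector `e_k - e_l`. -/
def pairVec (k l : ZMod n) (i : ZMod n) : ℤ := (if i = k then 1 else 0) - if i = l then 1 else 0

theorem pairState_eq (k l : ZMod n) :
    pairState k l = (1 / √2 : ℝ) • fun i => (pairVec k l i : ℝ) := by
  funext i
  simp [pairState, pairVec, Pi.single_apply]

theorem spectralSupport_smul {V : Type*} [Fintype V] (Q : Matrix V V ℝ) {c : ℝ} (hc : c ≠ 0)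
    (v : V → ℝ) : spectralSupport Q (c • v) = spectralSupport Q v := by
  ext θ
  simp [spectralSupport, dotProduct_smul, hc]

theorem natCast_ne_zero_of_lt {L : ℕ} (h0 : 0 < L) (hL : L < n) : (L : ZMod n) ≠ 0 := by
  rw [Ne, ZMod.natCast_eq_zero_iff]
  exact fun h => absurd (Nat.le_of_dvd h0 h) (by omega)

/-- The antisymmetric part of `e_k - e_l` has at most two positive entries, so a period `L` that is
nonzero has order two and exchanges them. -/
theorem pair_period {k l r : ZMod n} (hkl : k ≠ l) (hne : ¬ (k = r - k ∧ l = r - l)) {L : ZMod n}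
    (hL : L ≠ 0) (hper : ∀ i, (pairVec k l (i + L) - pairVec k l (r - (i + L)) : ℝ) =
      pairVec k l i - pairVec k l (r - i)) : L + L = 0 ∧ r - l = k + L := by
  have hpos : ∀ p, (0 : ℝ) < pairVec k l p - pairVec k l (r - p) → p = k ∨ p = r - l := by
    intro p hp
    by_contra h
    push Not at h
    obtain ⟨h1, h2⟩ := h
    have h3 : r - p ≠ l := fun h => h2 (by rw [← h]; ring)
    simp only [pairVec, h1, h3, if_false] at hp
    split_ifs at hp <;> norm_num at hp
  obtain ⟨p, hp⟩ : ∃ p, (0 : ℝ) < pairVec k l p - pairVec k l (r - p) := by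
    by_cases h1 : k = r - k
    · have h2 : l ≠ r - l := fun h => hne ⟨h1, h⟩
      have h3 : r - l ≠ k := fun h => hkl (by rw [h1, ← h]; ring)
      refine ⟨r - l, ?_⟩
      simp [pairVec, h2.symm, h3, hkl.symm]
    · refine ⟨k, ?_⟩
      simp only [pairVec, hkl, Ne.symm h1, if_true, if_false]
      split_ifs <;> norm_num
  have a0 := hpos p hp
  have hp1 := hp
  rw [← hper p] at hp1
  have a1 := hpos _ hp1
  have hp2 := hp1
  rw [← hper (p + L)] at hp2
  have a2 := hpos _ hp2
  have n1 : p + L ≠ p := fun h => hL (by linear_combination h)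
  have n2 : p + L + L ≠ p + L := fun h => hL (by linear_combination h)
  rcases a0 with a0 | a0 <;> rcases a1 with a1 | a1 <;> rcases a2 with a2 | a2
  · exact absurd (a1.trans a0.symm) n1
  · exact absurd (a1.trans a0.symm) n1
  · exact ⟨by linear_combination a2 - a0, by rw [← a1, a0]⟩
  · exact absurd (a2.trans a1.symm) n2
  · exact absurd (a2.trans a1.symm) n2
  · exact ⟨by linear_combination a2 - a0, by linear_combination a1 - a2⟩
  · exact absurd (a1.trans a0.symm) n1
  · exact absurd (a1.trans a0.symm) n1

variable [NeZero n] {b : ZMod n} {hb : b ≠ 0} {ρ : ℕ}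

theorem exists_isArithmetic (hn : 3 ≤ n) {S : Set ℝ} (hc : IsCommensurable S)
    {y : ZMod n → ℝ} {y' : ZMod n → ℤ}
    (hy : y = fun i => (y' i : ℝ)) (hS : spectralSupport (cycleEdgeQ b hb ρ) y ⊆ S) :
    ∃ Φ : Finset ℝ, (Φ : Set ℝ) = spectralSupport (cycleEdgeQ b hb ρ) y ∧ IsArithmetic Φ := by
  obtain ⟨g, hg⟩ := hc
  obtain ⟨N, hN⟩ := exists_int_cycleEdgeQ (hb := hb) (ρ := ρ) hn
  have hfin := spectralSupport_finite (cycleEdgeQ_transpose (hb := hb) (ρ := ρ)) y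
  refine ⟨hfin.toFinset, hfin.coe_toFinset, ?_, ?_, g, ?_⟩
  · exact exists_rat_map_eq_prod hN cycleEdgeQ_transpose hy hfin.coe_toFinset
  · exact fun θ hθ => isIntegral_of_mem_spectralSupport hN cycleEdgeQ_transpose y
      (hfin.mem_toFinset.mp hθ)
  · exact fun θ hθ φ hφ => hg θ (hS (hfin.mem_toFinset.mp hθ)) φ (hS (hfin.mem_toFinset.mp hφ))

/-- Passing to the antisymmetric part applies a matrix that commutes with `Q`, so it cannot
enlarge the support. -/
theorem spectralSupport_sub_reflection_subset (hn : 3 ≤ n) {r : ZMod n} (hr : PreservesEdge b r)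
    (x : ZMod n → ℝ) :
    spectralSupport (cycleEdgeQ b hb ρ) (fun i => x i - x (r - i)) ⊆
      spectralSupport (cycleEdgeQ b hb ρ) x := by
  have h : (fun i => x i - x (r - i)) = (1 - reflection r) *ᵥ x := by
    funext i
    rw [Matrix.sub_mulVec, Matrix.one_mulVec, Pi.sub_apply, reflection_mulVec]
  rw [h]
  exact spectralSupport_subset_of_commute cycleEdgeQ_transpose
    ((Commute.one_right _).sub_right (commute_reflection hn hr)) x

/-- If a reflection that preserves the additional edge does not fix both ends of the pair, then the
recurrences of the antisymmetric part determine `n` and the position of the pair. -/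
theorem periods_of_not_fixed (hn : 16 ≤ n) {k l r : ZMod n} (hkl : k ≠ l)
    (hr : PreservesEdge b r) (hne : ¬ (k = r - k ∧ l = r - l))
    (hc : IsCommensurable
      (spectralSupport (cycleEdgeQ b hb ρ) (fun i => (pairVec k l i : ℝ))))
    {z : ZMod n → ℝ} (hz : z = fun i => (pairVec k l i : ℝ) - pairVec k l (r - i)) :
    (n = 24 ∧ r - l = k + 12 ∧
      ∀ i, z (i + 6) + z (i - 6) + (z (i + 4) + z (i - 4)) - (z (i + 2) + z (i - 2)) = 2 * z i) ∨
    (n = 16 ∧ r - l = k + 8) ∨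
    (n = 24 ∧ r - l = k + 12 ∧ (∀ i, z (i + 3) + z (i - 3) = 0) ∧
      ∃ θ ∈ spectralSupport (cycleEdgeQ b hb ρ) (fun i => (pairVec k l i : ℝ)),
        (θ - 2) ^ 2 = 3) ∨
    (n = 20 ∧ r - l = k + 10) := by
  have hsub := spectralSupport_sub_reflection_subset (hb := hb) (ρ := ρ) (by omega : 3 ≤ n) hr
    (fun i => (pairVec k l i : ℝ))
  rw [← hz] at hsub
  obtain ⟨Φ, hΦ, harith⟩ := exists_isArithmetic (by omega : 3 ≤ n) hc (y := z)
    (y' := fun i => pairVec k l i - pairVec k l (r - i)) (by rw [hz]; push_cast; rfl) hsub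
  have hanti : IsAntisymm r z := by
    intro i
    simp only [hz, sub_sub_cancel]
    ring
  have hL : ∀ L : ℕ, 0 < L → L < 16 → (∀ i, z (i + L) = z i) →
      n ∣ 2 * L ∧ r - l = k + L := by
    intro L h0 h1 hper
    obtain ⟨h2, h3⟩ := pair_period hkl hne (natCast_ne_zero_of_lt h0 (h1.trans_le hn))
      (fun i => by simpa [hz] using hper i)
    refine ⟨?_, h3⟩
    rw [← ZMod.natCast_eq_zero_iff]
    push_cast
    linear_combination h2
  rcases hanti.periods (by omega : 3 ≤ n) hr hΦ harith with
    ⟨hper, hrec⟩ | hper | ⟨hper, hrec, θ, hθ, h3⟩ | hper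
  · obtain ⟨⟨q, hq⟩, h2⟩ := hL 12 (by norm_num) (by norm_num) (by exact_mod_cast hper)
    refine Or.inl ⟨?_, by exact_mod_cast h2, hrec⟩
    rcases q with _ | _ | q <;> nlinarith
  · obtain ⟨⟨q, hq⟩, h2⟩ := hL 8 (by norm_num) (by norm_num) (by exact_mod_cast hper)
    refine Or.inr (Or.inl ⟨?_, by exact_mod_cast h2⟩)
    rcases q with _ | _ | q <;> nlinarith
  · obtain ⟨⟨q, hq⟩, h2⟩ := hL 12 (by norm_num) (by norm_num) (by exact_mod_cast hper)
    refine Or.inr (Or.inr (Or.inl ⟨?_, by exact_mod_cast h2, hrec, θ, hsub hθ, h3⟩))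
    rcases q with _ | _ | q <;> nlinarith
  · obtain ⟨⟨q, hq⟩, h2⟩ := hL 10 (by norm_num) (by norm_num) (by exact_mod_cast hper)
    refine Or.inr (Or.inr (Or.inr ⟨?_, by exact_mod_cast h2⟩))
    rcases q with _ | _ | q <;> nlinarith

/-! ### The additional edge joins antipodal vertices -/

theorem eq_zero_or_eq_of_two_mul_val (hbn : 2 * b.val = n) {u : ZMod n} (hu : u + u = 0) :
    u = 0 ∨ u = b := by
  have h1 : ((2 * u.val : ℕ) : ZMod n) = 0 := by
    push_cast
    rw [ZMod.natCast_zmod_val]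
    linear_combination hu
  rw [ZMod.natCast_eq_zero_iff] at h1
  obtain ⟨q, hq⟩ := h1
  have h2 := ZMod.val_lt u
  rcases q with _ | _ | q
  · exact Or.inl ((ZMod.val_eq_zero u).mp (by omega))
  · exact Or.inr (ZMod.val_injective n (by omega))
  · nlinarith

/-- If `b = n / 2`, then every commensurable pair is negated by the reflection `i ↦ -i`, which fixes
`0` and `b`; but then `e_k - e_l` itself has a period. -/
theorem not_isCommensurable_antipodal (hn : 16 ≤ n) (hbn : 2 * b.val = n) {k l : ZMod n}
    (hkl : k ≠ l) : ¬ IsCommensurable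
      (spectralSupport (cycleEdgeQ b hb ρ) (fun i => (pairVec k l i : ℝ))) := by
  intro hc
  have hbb : b + b = 0 := by
    have : ((2 * b.val : ℕ) : ZMod n) = 0 := by rw [hbn]; simp
    push_cast at this
    rw [ZMod.natCast_zmod_val] at this
    linear_combination this
  have hbv : b = (b.val : ZMod n) := (ZMod.natCast_zmod_val b).symm
  have hl : l = -k := by
    by_cases hfix : k = b - k ∧ l = b - l
    · obtain ⟨h1, h2⟩ := hfix
      rcases eq_zero_or_eq_of_two_mul_val hbn (u := l - k) (by linear_combination h2 - h1) with h | h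
      · exact absurd (sub_eq_zero.mp h).symm hkl
      · linear_combination h + h1 + hbb
    · have h := periods_of_not_fixed (hb := hb) (ρ := ρ) hn hkl (Or.inl rfl) hfix hc rfl
      have key : ∀ L : ℕ, 2 * L = n → b - l = k + L → l = -k := by
        intro L hL h
        have : b = L := by rw [hbv]; congr 1; omega
        rw [← this] at h
        linear_combination -h
      rcases h with ⟨h1, h2, -⟩ | ⟨h1, h2⟩ | ⟨h1, h2, -⟩ | ⟨h1, h2⟩
      · exact key 12 h1.symm (by exact_mod_cast h2)
      · exact key 8 h1.symm (by exact_mod_cast h2)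
      · exact key 12 h1.symm (by exact_mod_cast h2)
      · exact key 10 h1.symm (by exact_mod_cast h2)
  subst hl
  obtain ⟨Φ, hΦ, harith⟩ := exists_isArithmetic (by omega : 3 ≤ n) hc (y' := pairVec k (-k)) rfl
    subset_rfl
  have hanti : IsAntisymm 0 (fun i => (pairVec k (-k) i : ℝ)) := by
    intro i
    have e1 : 0 - i = k ↔ i = -k := by rw [zero_sub, neg_eq_iff_eq_neg]
    have e2 : 0 - i = -k ↔ i = k := by rw [zero_sub, neg_inj]
    simp only [pairVec, e1, e2]
    push_cast
    ring
  have hL : ∀ L : ℕ, 0 < L → L < 16 →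
      ¬ ∀ i, (pairVec k (-k) (i + L) : ℝ) = pairVec k (-k) i := by
    intro L h0 h1 hper
    have h2 := hper k
    have h3 : k + L ≠ k := fun h =>
      natCast_ne_zero_of_lt h0 (h1.trans_le hn) (by linear_combination h)
    simp only [pairVec, h3, hkl, if_true, if_false] at h2
    split_ifs at h2 <;> norm_num at h2
  rcases hanti.periods (by omega : 3 ≤ n) (Or.inr ⟨rfl, hbb⟩) hΦ harith with
    ⟨hper, -⟩ | hper | ⟨hper, -⟩ | hper
  · exact hL 12 (by norm_num) (by norm_num) (by exact_mod_cast hper)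
  · exact hL 8 (by norm_num) (by norm_num) (by exact_mod_cast hper)
  · exact hL 12 (by norm_num) (by norm_num) (by exact_mod_cast hper)
  · exact hL 10 (by norm_num) (by norm_num) (by exact_mod_cast hper)

end Pair

/-! ### Locality of the additional edge -/

section Locality

variable {n : ℕ} [NeZero n] {b : ZMod n} {hb : b ≠ 0} {ρ : ℕ}

/-- At distance at least three from both ends of the additional edge, the cubic recurrence is that of
the cycle. -/
theorem aeval_chebyshev_three_apply (hn : 3 ≤ n) (y : ZMod n → ℝ) {f : ZMod n}
    (h : ∀ e ∈ [(-2 : ZMod n), -1, 0, 1, 2], f + e ≠ 0 ∧ f + e ≠ b) :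
    (aeval (cycleEdgeQ b hb ρ) ((Chebyshev.C ℝ 3).comp (X - C 2)) *ᵥ y) f =
      y (f + 3) + y (f - 3) := by
  have hloc : ∀ (u : ZMod n → ℝ) (i : ZMod n), i ≠ 0 ∧ i ≠ b →
      (aeval (cycleEdgeQ b hb ρ) (X - C 2 : ℝ[X]) *ᵥ u) i = u (i + 1) + u (i - 1) := by
    rintro u i ⟨h0, h1⟩
    simp only [map_sub, aeval_X, aeval_C, Matrix.sub_mulVec, Algebra.algebraMap_eq_smul_one,
      Matrix.smul_mulVec, Matrix.one_mulVec, Pi.sub_apply, Pi.smul_apply, smul_eq_mul,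
      cycleEdgeQ_mulVec hn, h0, h1, if_false]
    ring
  have hpoly : (Chebyshev.C ℝ 3).comp (X - C 2) =
      (X - C 2) * ((X - C 2) * (X - C 2)) - C 3 * (X - C 2) := by
    have h3 : Chebyshev.C ℝ 3 = X * (X * X) - C 3 * X := by
      rw [show (3 : ℤ) = 1 + 2 by norm_num, Chebyshev.C_add_two]
      norm_num [Chebyshev.C_two]
      rw [show (C 3 : ℝ[X]) = 3 from map_ofNat C 3]
      ring
    rw [h3]
    simp
  have hm2 := h (-2) (by simp)
  have hm1 := h (-1) (by simp)
  have h0 := h 0 (by simp)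
  have h1 := h 1 (by simp)
  have h2 := h 2 (by simp)
  rw [add_zero] at h0
  rw [hpoly, map_sub, map_mul, map_mul, map_mul, aeval_C, Matrix.sub_mulVec, Pi.sub_apply,
    ← Matrix.mulVec_mulVec, ← Matrix.mulVec_mulVec, Algebra.algebraMap_eq_smul_one,
    smul_mul_assoc, one_mul, Matrix.smul_mulVec, Pi.smul_apply, hloc _ _ h0, hloc _ _ h0,
    hloc _ (f + 1) h1, hloc _ (f - 1) (by simpa [sub_eq_add_neg] using hm1),
    hloc _ (f + 1 + 1) (by rwa [add_assoc, one_add_one_eq_two]),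
    hloc _ (f + 1 - 1) (by simpa using h0), hloc _ (f - 1 + 1) (by simpa using h0),
    hloc _ (f - 1 - 1) (by rwa [sub_sub, one_add_one_eq_two, sub_eq_add_neg])]
  rw [show f + 1 + 1 + 1 = f + 3 by ring, show f - 1 - 1 - 1 = f - 3 by ring,
    show f + 1 + 1 - 1 = f + 1 by ring, show f + 1 - 1 + 1 = f + 1 by ring,
    show f + 1 - 1 - 1 = f - 1 by ring, show f - 1 + 1 + 1 = f + 1 by ring,
    show f - 1 + 1 - 1 = f - 1 by ring, show f - 1 - 1 + 1 = f - 1 by ring, smul_eq_mul]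
  ring

/-! ### Pairs fixed by the reflection that exchanges the ends of the additional edge -/

/-- Closer to `k` than to its antipode, `Q ^ j (e_k - e_l)` vanishes outside the ball of radius `j`
around `k` and equals `1` on its boundary: the additional edge joins two points at the same distance
from `k`, so it is no shortcut. -/
theorem pow_mulVec_pairVec {m : ℕ} (hn : 3 ≤ n) (hm : n = 2 * m) {k : ZMod n} (hbk : b = 2 * k)
    (j : ℕ) :
    (∀ i : ℕ, j < i → i + j < m →
      ((cycleEdgeQ b hb ρ ^ j) *ᵥ fun i => (pairVec k (k + m) i : ℝ)) (k + i) = 0 ∧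
      ((cycleEdgeQ b hb ρ ^ j) *ᵥ fun i => (pairVec k (k + m) i : ℝ)) (k - i) = 0) ∧
    (2 * j < m →
      ((cycleEdgeQ b hb ρ ^ j) *ᵥ fun i => (pairVec k (k + m) i : ℝ)) (k + j) = 1 ∧
      ((cycleEdgeQ b hb ρ ^ j) *ᵥ fun i => (pairVec k (k + m) i : ℝ)) (k - j) = 1) := by
  have hcast : ∀ i : ℕ, 0 < i → i < n → (i : ZMod n) ≠ 0 := fun i h1 h2 =>
    natCast_ne_zero_of_lt h1 h2
  have hmm : (m : ZMod n) + m = 0 := by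
    have : ((2 * m : ℕ) : ZMod n) = 0 := by rw [← hm]; simp
    push_cast at this
    linear_combination this
  induction j with
  | zero =>
    have hpair : ∀ i : ℕ, i < m → pairVec k (k + m) (k + i) = if i = 0 then 1 else 0 := by
      intro i hi
      have h1 : (i : ZMod n) ≠ m := by
        intro h
        have := hcast (m - i) (by omega) (by omega)
        rw [Nat.cast_sub hi.le] at this
        exact this (sub_eq_zero.mpr h.symm)
      have h2 : (i : ZMod n) = 0 ↔ i = 0 :=
        ⟨fun h => by
          by_contra h0
          exact hcast i (by omega) (by omega) h, fun h => by simp [h]⟩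
      simp [pairVec, h1, h2]
    have hpair' : ∀ i : ℕ, i < m → pairVec k (k + m) (k - i) = if i = 0 then 1 else 0 := by
      intro i hi
      rw [← hpair i hi]
      have e1 : k - i = k ↔ k + i = k := by rw [sub_eq_self, add_eq_left]
      have e2 : k - i = k + m ↔ k + i = k + m := by
        constructor <;> intro h
        · linear_combination -h - hmm
        · linear_combination -h - hmm
      simp only [pairVec, e1, e2]
    refine ⟨fun i h1 h2 => ?_, fun h => ?_⟩
    · simp only [pow_zero, Matrix.one_mulVec]
      rw [hpair i (by omega), hpair' i (by omega), if_neg (by omega)]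
      simp
    · simp only [pow_zero, Matrix.one_mulVec]
      rw [hpair 0 (by omega), hpair' 0 (by omega)]
      simp
  | succ j ih =>
    obtain ⟨ih0, ih1⟩ := ih
    rw [pow_succ', ← Matrix.mulVec_mulVec]
    set y := (cycleEdgeQ b hb ρ ^ j) *ᵥ fun i => (pairVec k (k + m) i : ℝ) with hy
    -- the contribution of the additional edge to a vertex outside the ball vanishes
    have hedge : ∀ i : ℕ, j < i → i + j < m → ∀ v : ZMod n, v = k + i ∨ v = k - i →
        (cycleEdgeQ b hb ρ *ᵥ y) v = 2 * y v + y (v + 1) + y (v - 1) := by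
      intro i h1 h2 v hv
      obtain ⟨z1, z2⟩ := ih0 i h1 h2
      rw [cycleEdgeQ_mulVec hn]
      have h0b : v = 0 ∨ v = b → y 0 + y b = 0 := by
        intro h
        have : (0 = k + i ∧ b = k - i) ∨ (0 = k - i ∧ b = k + (i : ZMod n)) := by
          rcases hv with rfl | rfl <;> rcases h with h | h
          · exact Or.inl ⟨h.symm, by linear_combination hbk + h⟩
          · exact Or.inr ⟨by linear_combination hbk + h, h.symm⟩
          · exact Or.inr ⟨h.symm, by linear_combination hbk + h⟩
          · exact Or.inl ⟨by linear_combination hbk + h, h.symm⟩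
        rcases this with ⟨a1, a2⟩ | ⟨a1, a2⟩
        · rw [a2, a1, z1, z2, add_zero]
        · rw [a2, a1, z1, z2, add_zero]
      by_cases h : v = 0 ∨ v = b
      · rw [h0b h]; simp
      · push Not at h
        simp [h.1, h.2]
    have hs1 : ∀ i : ℕ, k + ((i + 1 : ℕ) : ZMod n) - 1 = k + i := fun i => by push_cast; ring
    have hs2 : ∀ i : ℕ, k - ((i + 1 : ℕ) : ZMod n) + 1 = k - i := fun i => by push_cast; ring
    have hs3 : ∀ i : ℕ, k + (i : ZMod n) + 1 = k + (i + 1 : ℕ) := fun i => by push_cast; ring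
    have hs4 : ∀ i : ℕ, k - (i : ZMod n) - 1 = k - (i + 1 : ℕ) := fun i => by push_cast; ring
    refine ⟨fun i h1 h2 => ?_, fun h => ?_⟩
    · obtain ⟨i, rfl⟩ : ∃ i', i = i' + 1 := ⟨i - 1, by omega⟩
      have a := ih0 i (by omega) (by omega)
      have a' := ih0 (i + 1) (by omega) (by omega)
      have a'' := ih0 (i + 1 + 1) (by omega) (by omega)
      rw [hedge (i + 1) (by omega) (by omega) _ (Or.inl rfl),
        hedge (i + 1) (by omega) (by omega) _ (Or.inr rfl), hs1, hs2, hs3, hs4, a.1, a.2, a'.1,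
        a'.2, a''.1, a''.2]
      simp
    · have a := ih1 (by omega)
      have a' := ih0 (j + 1) (by omega) (by omega)
      have a'' := ih0 (j + 1 + 1) (by omega) (by omega)
      rw [hedge (j + 1) (by omega) (by omega) _ (Or.inl rfl),
        hedge (j + 1) (by omega) (by omega) _ (Or.inr rfl), hs1, hs2, hs3, hs4, a.1, a.2, a'.1,
        a'.2, a''.1, a''.2]
      simp

/-- Points of `(0, 4]` at mutual distance at least one, and at most one further point. -/
theorem card_le_five {Φ : Finset ℝ} (h0 : ∀ θ ∈ Φ, 0 < θ)
    (hsep : ∀ θ ∈ Φ, ∀ φ ∈ Φ, θ ≠ φ → 1 ≤ |θ - φ|)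
    (huniq : ∀ θ ∈ Φ, ∀ φ ∈ Φ, 4 < θ → 4 < φ → θ = φ) : Φ.card ≤ 5 := by
  classical
  rw [← Finset.card_filter_add_card_filter_not (s := Φ) (fun θ => θ ≤ 4)]
  have h1 : (Φ.filter fun θ => θ ≤ 4).card ≤ 4 := by
    have hmap : Set.MapsTo Int.ceil ((Φ.filter fun θ => θ ≤ 4 : Finset ℝ) : Set ℝ)
        ((Finset.Icc (1 : ℤ) 4 : Finset ℤ) : Set ℤ) := by
      intro θ hθ
      simp only [Finset.coe_filter, Set.mem_ofPred_eq] at hθ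
      simp only [Finset.coe_Icc, Set.mem_Icc]
      exact ⟨Int.one_le_ceil_iff.mpr (h0 θ hθ.1), Int.ceil_le.mpr (by exact_mod_cast hθ.2)⟩
    have hinj : Set.InjOn Int.ceil ((Φ.filter fun θ => θ ≤ 4 : Finset ℝ) : Set ℝ) := by
      intro θ hθ φ hφ h
      simp only [Finset.coe_filter, Set.mem_ofPred_eq] at hθ hφ
      by_contra hne
      have h2 := hsep θ hθ.1 φ hφ.1 hne
      have a1 := Int.le_ceil θ
      have a2 := Int.ceil_lt_add_one θ
      have a3 := Int.le_ceil φ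
      have a4 := Int.ceil_lt_add_one φ
      rw [h] at a1 a2
      have h3 : |θ - φ| < 1 := by rw [abs_lt]; constructor <;> linarith
      linarith
    simpa using Finset.card_le_card_of_injOn _ hmap hinj
  have h2 : (Φ.filter fun θ => ¬ θ ≤ 4).card ≤ 1 := by
    rw [Finset.card_le_one]
    intro θ hθ φ hφ
    simp only [Finset.mem_filter, not_le] at hθ hφ
    exact huniq θ hθ.1 φ hφ.1 hθ.2 hφ.2
  omega

/-- For a pair fixed by the reflection, the support lies in `(0, 4]` up to one eigenvalue, so it has
at most five elements; the ball of radius five around `k` does not yet see the antipode, which makes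
the vectors `Q ^ j (e_k - e_l)` with `j ≤ 5` independent. -/
theorem not_isCommensurable_of_fixed (hn : 22 ≤ n) (hρ : 0 < ρ) {k l : ZMod n} (hkl : k ≠ l)
    (hk : k = b - k) (hl : l = b - l) : ¬ IsCommensurable
      (spectralSupport (cycleEdgeQ b hb ρ) (fun i => (pairVec k l i : ℝ))) := by
  intro hc
  have hbk : b = 2 * k := by linear_combination -hk
  obtain ⟨m, hm, hlm⟩ : ∃ m : ℕ, n = 2 * m ∧ l = k + m := by
    have h1 : ((2 * (l - k).val : ℕ) : ZMod n) = 0 := by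
      push_cast
      rw [ZMod.natCast_zmod_val]
      linear_combination hl - hk
    rw [ZMod.natCast_eq_zero_iff] at h1
    obtain ⟨q, hq⟩ := h1
    have h2 := ZMod.val_lt (l - k)
    have h3 : (l - k).val ≠ 0 := by
      rw [Ne, ZMod.val_eq_zero, sub_eq_zero]
      exact hkl.symm
    refine ⟨(l - k).val, ?_, by rw [ZMod.natCast_zmod_val]; ring⟩
    rcases q with _ | _ | q
    · omega
    · omega
    · nlinarith
  subst hlm
  have hn3 : 3 ≤ n := by omega
  obtain ⟨Φ, hΦ, harith⟩ := exists_isArithmetic hn3 hc (y' := pairVec k (k + m)) rfl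
    subset_rfl
  have heig : ∀ θ ∈ Φ, ∃ w : ZMod n → ℝ, w ≠ 0 ∧ cycleEdgeQ b hb ρ *ᵥ w = θ • w := by
    intro θ hθ
    obtain ⟨w, hw, hwy⟩ := hΦ.subset hθ
    exact ⟨w, fun h => hwy (by rw [h, zero_dotProduct]), hw⟩
  have hcard : Φ.card ≤ 5 := by
    refine card_le_five (fun θ hθ => ?_) (fun θ hθ φ hφ => harith.one_le_abs_sub hθ hφ)
      (fun θ hθ φ hφ h4 h4' => ?_)
    · obtain ⟨w, hw0, hw⟩ := heig θ hθ
      exact lt_of_le_of_ne (eigenvalue_nonneg hn3 hw0 hw)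
        (eigenvalue_ne_zero hn3 hρ hbk hw0 hw).symm
    · obtain ⟨w, hw0, hw⟩ := heig θ hθ
      obtain ⟨w', hw0', hw'⟩ := heig φ hφ
      exact eigenvalue_gt_four_unique hn3 hw0 hw0' hw hw' h4 h4'
  have hPm : (∏ θ ∈ Φ, (X - C θ)).Monic := monic_prod_of_monic _ _ fun θ _ => monic_X_sub_C θ
  have hPd : (∏ θ ∈ Φ, (X - C θ)).natDegree = Φ.card := by
    rw [natDegree_prod_of_monic _ _ fun θ _ => monic_X_sub_C θ]
    simp
  have h0 := congrFun (aeval_prod_mulVec_eq_zero cycleEdgeQ_transpose hΦ.symm.subset)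
    (k + Φ.card)
  -- the entry at distance `card Φ` from `k` only sees the leading term
  rw [aeval_eq_sum_range, hPd, Finset.sum_range_succ, ← hPd, hPm.coeff_natDegree, hPd, one_smul,
    Matrix.add_mulVec, Pi.add_apply, ((pow_mulVec_pairVec hn3 hm hbk _).2 (by omega)).1,
    Matrix.sum_mulVec, Finset.sum_apply, Finset.sum_eq_zero] at h0
  · norm_num at h0
  · intro j hj
    rw [Finset.mem_range] at hj
    rw [Matrix.smul_mulVec, Pi.smul_apply,
      ((pow_mulVec_pairVec hn3 hm hbk j).1 Φ.card hj (by omega)).1, smul_zero]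

end Locality

/-! ### The exceptional pairs on the cycle of length twenty-four -/

section TwentyFour

/-- The recurrence of the spectrum `{0, 1, 2, 3}` fails at `k`: the left side is at most `1` there,
while `z k = 1`. -/
theorem recurrence_even_ne : ∀ k l : ZMod 24, k ≠ l → l ≠ k + 12 → ∀ z : ZMod 24 → ℤ,
    (z = fun i => pairVec k l i - pairVec k l (k + l + 12 - i)) →
    z (k + 6) + z (k - 6) + (z (k + 4) + z (k - 4)) - (z (k + 2) + z (k - 2)) ≠ 2 * z k := by
  intro k l h1 h2 z hz
  subst hz
  revert k l
  decide +kernel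

/-- The recurrence of the spectrum `{2, 2 ± √3}` forces `l = k ± 6`; one of the two fixed points of
the reflection is far from the additional edge, and there the recurrence fails for `e_k - e_l`. -/
theorem exists_recurrence_three_ne : ∀ k l : ZMod 24, k ≠ l → l ≠ k + 12 → k + l + 12 ≠ 0 →
    ∀ z : ZMod 24 → ℤ, (z = fun i => pairVec k l i - pairVec k l (k + l + 12 - i)) →
    z (k + 3 + 3) + z (k + 3 - 3) = 0 →
    ∃ f : ZMod 24, (∀ e ∈ [(-2 : ZMod 24), -1, 0, 1, 2], f + e ≠ 0 ∧ f + e ≠ k + l + 12) ∧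
      pairVec k l (f + 3) + pairVec k l (f - 3) ≠ 0 := by
  intro k l h1 h2 h3 z hz
  subst hz
  revert k l
  decide +kernel

end TwentyFour

/-! ### Arbitrary position of the additional edge -/

section Generic

variable {n : ℕ} [NeZero n] {b : ZMod n} {hb : b ≠ 0} {ρ : ℕ}

/-- From `n = 22` on, no pair has a commensurable support, wherever the additional edge is. -/
theorem not_isCommensurable_of_le (hn : 22 ≤ n) (hρ : 0 < ρ) {k l : ZMod n}
    (hkl : k ≠ l) : ¬ IsCommensurable
      (spectralSupport (cycleEdgeQ b hb ρ) (fun i => (pairVec k l i : ℝ))) := by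
  by_cases hfix : k = b - k ∧ l = b - l
  · exact not_isCommensurable_of_fixed hn hρ hkl hfix.1 hfix.2
  intro hc
  have hn3 : 3 ≤ n := by omega
  have h := periods_of_not_fixed (hb := hb) (ρ := ρ) (by omega) hkl (Or.inl rfl) hfix hc rfl
  have hl12 : n = 24 → b - l = k + 12 → l ≠ k + 12 := by
    rintro rfl h1 h2
    have h24 : (12 : ZMod 24) + 12 = 0 := by decide
    exact hfix ⟨by linear_combination -h1 - h2 - h24, by linear_combination -h1 + h2⟩
  rcases h with ⟨rfl, h1, h2⟩ | ⟨rfl, -⟩ | ⟨rfl, h1, h2, θ₀, hθ₀, h3⟩ | ⟨rfl, -⟩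
  · have hb' : b = k + l + 12 := by linear_combination h1
    refine recurrence_even_ne k l hkl (hl12 rfl h1) _ rfl ?_
    have h3 := h2 k
    rw [hb'] at h3
    exact_mod_cast h3
  · omega
  · have hb' : b = k + l + 12 := by linear_combination h1
    obtain ⟨f, hf, hne⟩ := exists_recurrence_three_ne k l hkl (hl12 rfl h1) (hb' ▸ hb) _ rfl (by
      have h3 := h2 (k + 3)
      rw [hb'] at h3
      exact_mod_cast h3)
    rw [← hb'] at hf
    obtain ⟨Φ, hΦ, harith⟩ := exists_isArithmetic hn3 hc (y' := pairVec k l) rfl subset_rfl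
    have hmem : ∀ θ, θ ∈ Φ ↔ θ ∈ spectralSupport (cycleEdgeQ b hb ρ)
        (fun i => (pairVec k l i : ℝ)) := fun θ => by rw [← hΦ]; simp
    have hsupp := harith.sq_sub_two_eq_three (fun θ hθ => by
      obtain ⟨w, hw, hwy⟩ := (hmem θ).mp hθ
      exact eigenvalue_nonneg hn3 (fun h => hwy (by rw [h, zero_dotProduct])) hw)
      ((hmem _).mpr hθ₀) h3
    have h4 := aeval_comp_mulVec_eq_zero (cycleEdgeQ_transpose (hb := hb) (ρ := ρ))
      (y := fun i => (pairVec k l i : ℝ)) (p := Chebyshev.C ℝ 3) (fun θ hθ => by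
        have c3 := eval_chebyshev_three_mul 1 (θ - 2)
        norm_num at c3
        rw [c3]
        rcases hsupp θ ((hmem θ).mpr hθ) with rfl | h5
        · norm_num
        · linear_combination (θ - 2) * h5)
    have h5 := congrFun h4 f
    rw [aeval_chebyshev_three_apply hn3 _ hf, Pi.zero_apply] at h5
    exact hne (by exact_mod_cast h5)
  · omega

end Generic

theorem HasPairPST.exists_isCommensurable {V : Type*} [Fintype V] [DecidableEq V]
    {M : Matrix V V ℝ} (hM : Mᵀ = M) (h : HasPairPST M) :
    ∃ k l : V, k ≠ l ∧ IsCommensurable (spectralSupport M (pairState k l)) := by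
  obtain ⟨k, l, k', l', hkl, -, -, hpst⟩ := h
  exact ⟨k, l, hkl, hpst.isCommensurable hM⟩

end QuantumWalk

theorem mainTheorem5 (n : ℕ) [NeZero n] (b : ZMod n) (hb : b ≠ 0) (ρ : ℕ) (hρ : 0 < ρ) :
    (2 * b.val = n → 16 ≤ n →
      ¬ QuantumWalk.HasPairPST
        ((WeightedGraph.cycle n).addEdge 0 b hb.symm (ρ : ℝ≥0)).signlessLaplacian) ∧
    (2 * b.val ≠ n → 22 ≤ n →
      ¬ QuantumWalk.HasPairPST
        ((WeightedGraph.cycle n).addEdge 0 b hb.symm (ρ : ℝ≥0)).signlessLaplacian) := by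
  have key : QuantumWalk.HasPairPST
      ((WeightedGraph.cycle n).addEdge 0 b hb.symm (ρ : ℝ≥0)).signlessLaplacian →
      ∃ k l : ZMod n, k ≠ l ∧ QuantumWalk.IsCommensurable
        (QuantumWalk.spectralSupport (QuantumWalk.cycleEdgeQ b hb ρ)
          (fun i => (QuantumWalk.pairVec k l i : ℝ))) := by
    intro h
    obtain ⟨k, l, hkl, hc⟩ :=
      h.exists_isCommensurable (QuantumWalk.cycleEdgeQ_transpose (hb := hb) (ρ := ρ))
    rw [QuantumWalk.pairState_eq, QuantumWalk.spectralSupport_smul _ (by positivity)] at hc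
    exact ⟨k, l, hkl, hc⟩
  refine ⟨fun hbn hn h => ?_, fun _ hn h => ?_⟩
  · obtain ⟨k, l, hkl, hc⟩ := key h
    exact QuantumWalk.not_isCommensurable_antipodal hn hbn hkl hc
  · obtain ⟨k, l, hkl, hc⟩ := key h
    exact QuantumWalk.not_isCommensurable_of_le hn hρ hkl hc
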